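/- Let $A_1,\dots,A_N\in GL_2(\mathbb R)$ have Euclidean operator norm $\|A_i\|<1$, let $\Sigma=\{1,\dots,N\}^{\mathbb N}$ with left shift $\sigma$, and let $\Sigma_n$ be the set of words of length $n$. For a finite word $\mathtt i=i_1\cdots i_n$ put $A_{\mathtt i}=A_{i_1}\cdots A_{i_n}$, let $\alpha_1(\mathtt i)\ge\alpha_2(\mathtt i)$ be the singular values of $A_{\mathtt i}$, let $[\mathtt i]\subset\Sigma$ be the cylinder of $\mathtt i$, and for $s\ge 0$ set $$\varphi^s(\mathtt i)=\begin{cases}\alpha_1(\mathtt i)^s,&0\le s<1,\\ \alpha_1(\mathtt i)\alpha_2(\mathtt i)^{s-1},&1\le s<2,\\ |\det A_{\mathtt i}|^{s/2},&s\ge 2.\end{cases}$$ Assume that $(A_1,\dots,A_N)$ is dominated: there are $C>0$ and $0<t<1$ with $\alpha_2(\mathtt i)\le C t^{n}\alpha_1(\mathtt i)$ for all $n$ and $\mathtt i\in\Sigma_n$. Let $\mu$ be a Borel probability measure on $\Sigma$ that is fully supported ($\mu([\mathtt i])>0$ for every finite word $\mathtt i$) and quasi-Bernoulli: there is $C\ge1$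 with $C^{-1}\mu([\mathtt i])\mu([\mathtt j])\le\mu([\mathtt i\mathtt j])\le C\mu([\mathtt i])\mu([\mathtt j])$ for all finite words $\mathtt i,\mathtt j$. For a positive function $\theta$ on finite words and a $\sigma$-invariant Borel probability measure $\nu$ on $\Sigma$ write, when the limits exist (as they do below), $$P(\theta)=\lim_{n\to\infty}\tfrac1n\log\sum_{\mathtt i\in\Sigma_n}\theta(\mathtt i),\quad \Lambda(\theta,\nu)=\lim_{n\to\infty}\tfrac1n\int_\Sigma\log\theta(\mathtt i|_n)\,d\nu(\mathtt i),\quad h(\nu)=-\lim_{n\to\infty}\tfrac1n\sum_{\mathtt i\in\Sigma_n}\nu([\mathtt i])\log\nu([\mathtt i]).$$ A $\sigma$-invariant $\nu$ is an equilibrium state for $\theta$ if $P(\theta)=h(\nu)+\Lambda(\theta,\nu)$. The Lyapunov dimension $\dim_L(\nu)$ is the unique $s\ge0$ with $h(\nu)+\Lambda(\varphi^s,\nu)=0$. For $q\in\mathbb R$, $s\ge0$ let $\psi^{q,s}(\mathtt i)=\mu([\mathtt i])^q\varphi^s(\mathtt i)^{1-q}$. For $q\ne1$ let $\tau(q)=(q-1)s_q$,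 where $s_q$ is the unique $s\ge 0$ with $P(\psi^{q,s})=0$, and let $\tau(1)=0$. **Theorem.** Let $q\in\mathbb R\setminus\{1\}$ and suppose that $\tau(q)/(q-1)$ and $q\tau'(q)-\tau(q)$ are contained in the same one of the intervals $(0,1)$, $(1,2)$, $(2,\infty)$. Then $\tau$ is differentiable at $q$, the potential $\psi^{q,\tau(q)/(q-1)}$ has a unique equilibrium state $\nu$, and $$\dim_L(\nu)=q\tau'(q)-\tau(q).$$ (In the hypothesis, $\tau'(q)$ is read as $0$ should $\tau$ fail to be differentiable at $q$; the conclusion says that this does not happen.) -/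

import Mathlib

open MeasureTheory Filter Topology

namespace SelfAffine

noncomputable section

/-! ### The shift space -/

/-- The shift space of infinite words over the alphabet `{0, …, N - 1}`; it carries the product
σ-algebra, which is the Borel σ-algebra of the product topology. Finite words are lists. -/
abbrev Shift (N : ℕ) : Type := ℕ → Fin N

/-- The prefix of length `n` of an infinite word. -/
def pre {N : ℕ} (x : Shift N) (n : ℕ) : List (Fin N) := List.ofFn (fun k : Fin n => x k)

/-- The cylinder set of a finite word. -/
def cylinder {N : ℕ} (w : List (Fin N)) : Set (Shift N) := {x | pre x w.length = w}

/-- The left shift. -/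
def leftShift {N : ℕ} (x : Shift N) : Shift N := fun k => x (k + 1)

/-- Shift-invariant Borel probability measures. -/
def IsInvariantProb {N : ℕ} (ν : Measure (Shift N)) : Prop :=
  IsProbabilityMeasure ν ∧ MeasurePreserving leftShift ν ν

/-- Every cylinder set has positive measure. -/
def FullySupported {N : ℕ} (μ : Measure (Shift N)) : Prop :=
  ∀ w : List (Fin N), 0 < μ (cylinder w)

/-! ### Potentials -/

/-- The sum of a function of finite words over all words of length `n`. -/
def wordSum {N : ℕ} (n : ℕ) (θ : List (Fin N) → ℝ) : ℝ :=
  ∑ w : Fin n → Fin N, θ (List.ofFn w)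

def SubMultiplicative {N : ℕ} (θ : List (Fin N) → ℝ) : Prop :=
  ∀ v w : List (Fin N), θ (v ++ w) ≤ θ v * θ w

def SuperMultiplicative {N : ℕ} (θ : List (Fin N) → ℝ) : Prop :=
  SubMultiplicative (fun w => (θ w)⁻¹)

def AlmostMultiplicative {N : ℕ} (θ : List (Fin N) → ℝ) : Prop :=
  ∃ C : ℝ, 1 ≤ C ∧ SubMultiplicative (fun w => C * θ w) ∧
    SuperMultiplicative (fun w => C⁻¹ * θ w)

/-- A fully supported measure is quasi-Bernoulli if the potential `w ↦ μ [w]` is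
almost-multiplicative. -/
def QuasiBernoulli {N : ℕ} (μ : Measure (Shift N)) : Prop :=
  FullySupported μ ∧ AlmostMultiplicative (fun w => μ.real (cylinder w))

/-- `Λ(θ, ν) = lim (1/n) ∫ log θ(x|ₙ) dν(x)`. -/
def Lam {N : ℕ} (θ : List (Fin N) → ℝ) (ν : Measure (Shift N)) : ℝ :=
  limUnder atTop (fun n : ℕ => (1 / (n : ℝ)) * ∫ x, Real.log (θ (pre x n)) ∂ν)

/-- The entropy `h(ν) = - lim (1/n) ∑ ν[w] log ν[w]`, the sum being over words of length `n`. -/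
def entropy {N : ℕ} (ν : Measure (Shift N)) : ℝ :=
  limUnder atTop (fun n : ℕ => -((1 / (n : ℝ)) *
    wordSum n (fun w : List (Fin N) => ν.real (cylinder w) * Real.log (ν.real (cylinder w)))))

/-- The pressure `P(θ) = lim (1/n) log ∑ θ(w)`, the sum being over words of length `n`. -/
def pressure {N : ℕ} (θ : List (Fin N) → ℝ) : ℝ :=
  limUnder atTop (fun n : ℕ => (1 / (n : ℝ)) * Real.log (wordSum n θ))

/-- `ν` is an equilibrium state for `θ`. -/
def IsEquilibriumState {N : ℕ} (θ : List (Fin N) → ℝ) (ν : Measure (Shift N)) : Prop :=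
  IsInvariantProb ν ∧ pressure θ = entropy ν + Lam θ ν

/-! ### Matrix tuples -/

/-- The Euclidean operator norm of a real `2 × 2` matrix. -/
def opNorm (M : Matrix (Fin 2) (Fin 2) ℝ) : ℝ :=
  ‖Matrix.toEuclideanCLM (n := Fin 2) (𝕜 := ℝ) M‖

/-- The product `A_w = A_{w₁} ⋯ A_{wₙ}`. -/
def wordProd {N : ℕ} (A : Fin N → Matrix.GeneralLinearGroup (Fin 2) ℝ) (w : List (Fin N)) :
    Matrix.GeneralLinearGroup (Fin 2) ℝ :=
  (w.map A).prod

/-- The larger singular value of `A_w`. -/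
def alpha₁ {N : ℕ} (A : Fin N → Matrix.GeneralLinearGroup (Fin 2) ℝ) (w : List (Fin N)) : ℝ :=
  opNorm (wordProd A w : Matrix (Fin 2) (Fin 2) ℝ)

/-- The smaller singular value of `A_w`. -/
def alpha₂ {N : ℕ} (A : Fin N → Matrix.GeneralLinearGroup (Fin 2) ℝ) (w : List (Fin N)) : ℝ :=
  (opNorm (((wordProd A w)⁻¹ : Matrix.GeneralLinearGroup (Fin 2) ℝ) :
    Matrix (Fin 2) (Fin 2) ℝ))⁻¹

/-- Every matrix of the tuple is a strict contraction in the Euclidean norm. -/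
def Contractive {N : ℕ} (A : Fin N → Matrix.GeneralLinearGroup (Fin 2) ℝ) : Prop :=
  ∀ i, opNorm (A i : Matrix (Fin 2) (Fin 2) ℝ) < 1

def Dominated {N : ℕ} (A : Fin N → Matrix.GeneralLinearGroup (Fin 2) ℝ) : Prop :=
  ∃ C t : ℝ, 0 < C ∧ 0 < t ∧ t < 1 ∧
    ∀ w : List (Fin N), alpha₂ A w ≤ C * t ^ w.length * alpha₁ A w

/-- The singular value function `φ^s`, for `s ≥ 0`. -/
def svf {N : ℕ} (A : Fin N → Matrix.GeneralLinearGroup (Fin 2) ℝ) (s : ℝ) (w : List (Fin N)) :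
    ℝ :=
  if s < 1 then alpha₁ A w ^ s
  else if s < 2 then alpha₁ A w * alpha₂ A w ^ (s - 1)
  else |(wordProd A w : Matrix (Fin 2) (Fin 2) ℝ).det| ^ (s / 2)

/-- `d` is the Lyapunov dimension of `ν`: the unique `s ≥ 0` with `h(ν) + Λ(φ^s, ν) = 0`. -/
def IsLyapunovDim {N : ℕ} (A : Fin N → Matrix.GeneralLinearGroup (Fin 2) ℝ)
    (ν : Measure (Shift N)) (d : ℝ) : Prop :=
  (0 ≤ d ∧ entropy ν + Lam (svf A d) ν = 0) ∧
    ∀ s : ℝ, 0 ≤ s → entropy ν + Lam (svf A s) ν = 0 → s = d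

/-- The potential `ψ^{q,s}(w) = μ[w]^q φ^s(w)^(1-q)`. -/
def psi {N : ℕ} (A : Fin N → Matrix.GeneralLinearGroup (Fin 2) ℝ) (μ : Measure (Shift N))
    (q s : ℝ) (w : List (Fin N)) : ℝ :=
  μ.real (cylinder w) ^ q * svf A s w ^ (1 - q)

/-- The zero `s_q` of `s ↦ P(ψ^{q,s})` on `[0, ∞)`; for a dominated tuple of contractions, a
quasi-Bernoulli `μ` and `q ≠ 1` there is exactly one. -/
def pressureZero {N : ℕ} (A : Fin N → Matrix.GeneralLinearGroup (Fin 2) ℝ)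
    (μ : Measure (Shift N)) (q : ℝ) : ℝ :=
  sInf {s : ℝ | 0 ≤ s ∧ pressure (psi A μ q s) = 0}

/-- The `L^q`-spectrum `τ(q) = (q - 1) s_q`, with `τ(1) = 0`. -/
def Lqτ {N : ℕ} (A : Fin N → Matrix.GeneralLinearGroup (Fin 2) ℝ) (μ : Measure (Shift N))
    (q : ℝ) : ℝ :=
  if q = 1 then 0 else (q - 1) * pressureZero A μ q

end

end SelfAffine

/-! On each of the three intervals the singular value function has the form b · c^s with `b`, `c`
independent of s. There ψ^{q,s} = μ^q b^(1-q) c^(-t) with t = (q-1)s, and τ is locally the curve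
along which the pressure of this two-parameter family vanishes. By the variational inequality h + Λ
≤ P, an equilibrium state at (q, τ(q)) supplies an affine minorant of the pressure that touches it
there. Comparing the minorants at (q, τ(q)) and (q', τ(q')) squeezes τ(q') - τ(q) between (q' - q)
times the values at q' and at q of the slope (Λ(μ,ν) - Λ(b,ν)) / Λ(c,ν). Once this slope is known to
vary continuously, it is τ'(q), without differentiating the pressure
(`hasDerivAt_of_pressure_family_eq_zero`). Substituting Λ(μ,ν) = Λ(b,ν) + τ'(q) Λ(c,ν) into 0 = h(ν)
+ q Λ(μ,ν) + (1-q) Λ(b,ν) - τ(q) Λ(c,ν) leaves h(ν) + Λ(b,ν) + d Λ(c,ν) = 0 with d = qτ'(q) - τ(q).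
Since d lies in the same interval, the last two terms are Λ(φ^d,ν).

Existence, uniqueness and continuity of equilibrium states rest on almost multiplicativity of the
potentials. Shift averages of atomic measures converge to a Gibbs state
(`AlmostMul.exists_isGibbs`), which is ergodic. Any equilibrium state has bounded relative entropy
with respect to it, hence is absolutely continuous, hence equal to it
(`IsGibbs.eq_of_isEquilibriumState`). Gibbs bounds pass to limits, so uniqueness also yields
continuity in the parameters (`tendsto_cylinder_family`).

Domination enters through `exists_alpha₁_mul_le`: a direction that is stretched a lot and then
contracted back, relative to the determinant, would contradict it. Hence α₁ is almost
multiplicative; the determinant is multiplicative and α₂ = |det| / α₁, which covers every φ^s. -/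

namespace SelfAffine

/-! ### Words, cylinders and measures on the shift space -/

section Words

variable {N : ℕ}

theorem wordSum_add (m n : ℕ) (θ : List (Fin N) → ℝ) :
    wordSum (m + n) θ = wordSum m (fun u => wordSum n (fun v => θ (u ++ v))) := by
  unfold wordSum
  rw [← Fintype.sum_prod_type', ← (Fin.appendEquiv m n).sum_comp]
  refine Finset.sum_congr rfl fun p _ => ?_
  simp [Fin.appendEquiv, List.ofFn_fin_append]

theorem wordSum_congr {n : ℕ} {θ θ' : List (Fin N) → ℝ} (h : ∀ w, w.length = n → θ w = θ' w) :
    wordSum n θ = wordSum n θ' :=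
  Finset.sum_congr rfl fun _ _ => h _ (by simp)

theorem wordSum_le_wordSum {n : ℕ} {θ θ' : List (Fin N) → ℝ}
    (h : ∀ w, w.length = n → θ w ≤ θ' w) : wordSum n θ ≤ wordSum n θ' :=
  Finset.sum_le_sum fun _ _ => h _ (by simp)

theorem wordSum_mul_left (n : ℕ) (c : ℝ) (θ : List (Fin N) → ℝ) :
    wordSum n (fun w => c * θ w) = c * wordSum n θ := by
  simp [wordSum, Finset.mul_sum]

theorem wordSum_mul_right (n : ℕ) (c : ℝ) (θ : List (Fin N) → ℝ) :
    wordSum n (fun w => θ w * c) = wordSum n θ * c := by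
  simp [wordSum, Finset.sum_mul]

theorem wordSum_add_fun (n : ℕ) (θ θ' : List (Fin N) → ℝ) :
    wordSum n (fun w => θ w + θ' w) = wordSum n θ + wordSum n θ' := by
  simp [wordSum, Finset.sum_add_distrib]

theorem wordSum_sub_fun (n : ℕ) (θ θ' : List (Fin N) → ℝ) :
    wordSum n (fun w => θ w - θ' w) = wordSum n θ - wordSum n θ' := by
  simp [wordSum, Finset.sum_sub_distrib]

theorem wordSum_comm (m n : ℕ) (θ : List (Fin N) → List (Fin N) → ℝ) :
    wordSum m (fun u => wordSum n (fun v => θ u v))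
      = wordSum n (fun v => wordSum m (fun u => θ u v)) := by
  unfold wordSum
  exact Finset.sum_comm

theorem wordSum_pos [NeZero N] {n : ℕ} {θ : List (Fin N) → ℝ} (h : ∀ w, 0 < θ w) :
    0 < wordSum n θ :=
  Finset.sum_pos (fun _ _ => h _) Finset.univ_nonempty

theorem wordSum_nonneg {n : ℕ} {θ : List (Fin N) → ℝ} (h : ∀ w, 0 ≤ θ w) :
    0 ≤ wordSum n θ :=
  Finset.sum_nonneg fun _ _ => h _

theorem exists_ofFn_eq {n : ℕ} {w : List (Fin N)} (hw : w.length = n) :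
    ∃ f : Fin n → Fin N, List.ofFn f = w := by
  subst hw
  exact ⟨w.get, List.ofFn_get w⟩

theorem wordSum_ite_eq {w : List (Fin N)} (θ : List (Fin N) → ℝ) :
    wordSum w.length (fun v => if v = w then θ v else 0) = θ w := by
  obtain ⟨f, hf⟩ := exists_ofFn_eq (w := w) rfl
  unfold wordSum
  rw [Finset.sum_eq_single f]
  · simp [hf]
  · intro g _ hg
    refine if_neg fun h => hg (List.ofFn_injective (h.trans hf.symm))
  · simp

@[simp] theorem length_pre (x : Shift N) (n : ℕ) : (pre x n).length = n := by simp [pre]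

theorem leftShift_iterate_apply (m : ℕ) (x : Shift N) (k : ℕ) :
    leftShift^[m] x k = x (k + m) := by
  induction m generalizing x with
  | zero => rfl
  | succ m ih => rw [Function.iterate_succ_apply, ih]; simp [leftShift, add_assoc]

theorem pre_add (x : Shift N) (m n : ℕ) :
    pre x (m + n) = pre x m ++ pre (leftShift^[m] x) n := by
  unfold pre
  rw [← List.ofFn_fin_append]
  congr 1
  funext i
  refine Fin.addCases (fun i => ?_) (fun i => ?_) i
  · simp
  · simp [leftShift_iterate_apply, add_comm]

theorem cylinder_append (u v : List (Fin N)) :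
    cylinder (u ++ v) = cylinder u ∩ leftShift^[u.length] ⁻¹' cylinder v := by
  ext x
  simp only [cylinder, Set.mem_ofPred_eq, List.length_append, pre_add, Set.mem_inter_iff,
    Set.mem_preimage]
  constructor
  · intro h
    exact List.append_inj h (by simp)
  · rintro ⟨h1, h2⟩
    rw [h1, h2]

theorem mem_cylinder_pre (x : Shift N) (n : ℕ) : x ∈ cylinder (pre x n) := by
  simp [cylinder]

theorem mem_cylinder_iff {x : Shift N} {n : ℕ} {w : List (Fin N)} (hw : w.length = n) :
    x ∈ cylinder w ↔ pre x n = w := by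
  subst hw; rfl

theorem continuous_leftShift : Continuous (leftShift (N := N)) :=
  continuous_pi fun k => continuous_apply (k + 1)

theorem measurable_leftShift : Measurable (leftShift (N := N)) :=
  measurable_pi_lambda _ fun k => measurable_pi_apply (k + 1)

theorem isClopen_preimage_pre (n : ℕ) (S : Set (Fin n → Fin N)) :
    IsClopen {x : Shift N | (fun k : Fin n => x k) ∈ S} := by
  have : Continuous (fun (x : Shift N) (k : Fin n) => x k) :=
    continuous_pi fun k => continuous_apply _
  exact (isClopen_discrete S).preimage this

theorem isClopen_cylinder (w : List (Fin N)) : IsClopen (cylinder w) := by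
  have := isClopen_preimage_pre (N := N) w.length {f | List.ofFn f = w}
  exact this

theorem measurableSet_cylinder (w : List (Fin N)) : MeasurableSet (cylinder w) :=
  (isClopen_cylinder w).isOpen.measurableSet

theorem integral_pre (ν : Measure (Shift N)) [IsFiniteMeasure ν] (n : ℕ)
    (g : List (Fin N) → ℝ) :
    ∫ x, g (pre x n) ∂ν = wordSum n (fun w => ν.real (cylinder w) * g w) := by
  have hm : Measurable (fun (x : Shift N) (k : Fin n) => x k) :=
    measurable_pi_lambda _ fun k => measurable_pi_apply _
  have h1 : ∫ x, g (pre x n) ∂ν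
      = ∫ f, g (List.ofFn f) ∂(ν.map (fun (x : Shift N) (k : Fin n) => x k)) := by
    rw [integral_map hm.aemeasurable]
    · rfl
    · exact (measurable_of_finite _).aestronglyMeasurable
  rw [h1, integral_fintype (Integrable.of_finite)]
  refine Finset.sum_congr rfl fun f _ => ?_
  rw [map_measureReal_apply hm (measurableSet_singleton f), smul_eq_mul]
  congr 2
  ext x
  simp only [Set.mem_preimage, Set.mem_singleton_iff]
  rw [mem_cylinder_iff (n := n) (by simp)]
  exact ⟨fun h => by rw [← h]; rfl, fun h => List.ofFn_injective h⟩

theorem measureReal_eq_wordSum (ν : Measure (Shift N)) [IsFiniteMeasure ν] (n : ℕ)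
    (B : Set (Shift N)) :
    ν.real B = wordSum n (fun w => ν.real (cylinder w ∩ B)) := by
  have h := integral_pre (ν.restrict B) n (fun _ => 1)
  simp only [integral_const, smul_eq_mul, mul_one] at h
  simp only [measureReal_restrict_apply, MeasurableSet.univ, Set.univ_inter,
    measurableSet_cylinder] at h
  exact h

theorem wordSum_cylinder (ν : Measure (Shift N)) [IsProbabilityMeasure ν] (n : ℕ) :
    wordSum n (fun w => ν.real (cylinder w)) = 1 := by
  have := measureReal_eq_wordSum ν n Set.univ
  simpa using this.symm

theorem wordSum_cylinder_append_right (ν : Measure (Shift N)) [IsFiniteMeasure ν] (n : ℕ)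
    (u : List (Fin N)) :
    wordSum n (fun v => ν.real (cylinder (u ++ v))) = ν.real (cylinder u) := by
  let κ := (ν.restrict (cylinder u)).map (leftShift^[u.length])
  have hm : Measurable (leftShift^[u.length] : Shift N → Shift N) :=
    measurable_leftShift.iterate _
  have : IsFiniteMeasure κ := by dsimp [κ]; infer_instance
  have h := measureReal_eq_wordSum κ n Set.univ
  have h2 : ∀ B, MeasurableSet B →
      κ.real B = ν.real (cylinder u ∩ leftShift^[u.length] ⁻¹' B) := by
    intro B hB
    rw [map_measureReal_apply hm hB, measureReal_restrict_apply (hm hB), Set.inter_comm]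
  rw [h2 _ MeasurableSet.univ] at h
  simp only [Set.preimage_univ, Set.inter_univ] at h
  rw [h]
  refine wordSum_congr fun v _ => ?_
  rw [h2 _ (measurableSet_cylinder v), cylinder_append]

theorem wordSum_cylinder_append_left (ν : Measure (Shift N)) [IsFiniteMeasure ν]
    (hν : MeasurePreserving leftShift ν ν) (n : ℕ) (v : List (Fin N)) :
    wordSum n (fun u => ν.real (cylinder (u ++ v))) = ν.real (cylinder v) := by
  have hp := hν.iterate n
  rw [← hp.measureReal_preimage (measurableSet_cylinder v).nullMeasurableSet,
    measureReal_eq_wordSum ν n (leftShift^[n] ⁻¹' cylinder v)]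
  refine wordSum_congr fun u hu => ?_
  rw [cylinder_append, hu]

/-- The union of the cylinders of length `n` that are contained in `U`. -/
def innerCyl (U : Set (Shift N)) (n : ℕ) : Set (Shift N) := {x | cylinder (pre x n) ⊆ U}

theorem innerCyl_subset (U : Set (Shift N)) (n : ℕ) : innerCyl U n ⊆ U :=
  fun x hx => hx (mem_cylinder_pre x n)

theorem cylinder_pre_antitone (x : Shift N) {m n : ℕ} (h : m ≤ n) :
    cylinder (pre x n) ⊆ cylinder (pre x m) := by
  obtain ⟨k, rfl⟩ := Nat.exists_eq_add_of_le h
  rw [pre_add, cylinder_append]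
  exact Set.inter_subset_left

theorem monotone_innerCyl (U : Set (Shift N)) : Monotone (innerCyl U) :=
  fun _ _ h x hx => (cylinder_pre_antitone x h).trans hx

theorem iUnion_innerCyl {U : Set (Shift N)} (hU : IsOpen U) : ⋃ n, innerCyl U n = U := by
  refine Set.Subset.antisymm (Set.iUnion_subset fun n => innerCyl_subset U n) fun x hx => ?_
  obtain ⟨I, u, hu, hsub⟩ := isOpen_pi_iff.1 hU x hx
  obtain ⟨n, hn⟩ : ∃ n : ℕ, ∀ i ∈ I, i < n := ⟨I.sup id + 1, fun i hi =>
    Nat.lt_succ_of_le (Finset.le_sup (f := id) hi)⟩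
  refine Set.mem_iUnion.2 ⟨n, fun y hy => hsub fun i hi => ?_⟩
  have hy' : pre y n = pre x n := (mem_cylinder_iff (by simp)).1 hy
  have := congrFun (List.ofFn_injective hy') ⟨i, hn i hi⟩
  simp only at this
  rw [this]
  exact (hu i hi).2

open Classical in
theorem measureReal_innerCyl (ν : Measure (Shift N)) [IsFiniteMeasure ν]
    (U : Set (Shift N)) (n : ℕ) :
    ν.real (innerCyl U n)
      = wordSum n (fun w => if cylinder w ⊆ U then ν.real (cylinder w) else 0) := by
  rw [measureReal_eq_wordSum ν n (innerCyl U n)]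
  refine wordSum_congr fun w hw => ?_
  split_ifs with h
  · congr 1
    refine Set.inter_eq_left.2 fun x hx => ?_
    rw [mem_cylinder_iff hw] at hx
    simpa [innerCyl, hx] using h
  · rw [show cylinder w ∩ innerCyl U n = ∅ from ?_]
    · simp
    · ext x
      simp only [Set.mem_inter_iff, Set.mem_empty_iff_false, iff_false, not_and]
      intro hx hx'
      rw [mem_cylinder_iff hw] at hx
      exact h (by simpa [innerCyl, hx] using hx')

theorem tendsto_measure_innerCyl (ν : Measure (Shift N)) {U : Set (Shift N)} (hU : IsOpen U) :
    Tendsto (fun n => ν (innerCyl U n)) atTop (𝓝 (ν U)) := by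
  have := tendsto_measure_iUnion_atTop (μ := ν) (monotone_innerCyl U)
  rwa [iUnion_innerCyl hU] at this

/-- An open set is the increasing union of its sets `innerCyl`, each a disjoint union of cylinders
of one length, so the inequality passes to open sets; outer regularity of `m₂` carries it to all
Borel sets. -/
theorem measure_le_of_cylinder_le {m₁ m₂ : Measure (Shift N)} [IsFiniteMeasure m₁]
    [IsFiniteMeasure m₂] (h : ∀ w, m₁.real (cylinder w) ≤ m₂.real (cylinder w)) : m₁ ≤ m₂ := by
  have hopen : ∀ U : Set (Shift N), IsOpen U → m₁ U ≤ m₂ U := by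
    intro U hU
    refine le_of_tendsto_of_tendsto' (tendsto_measure_innerCyl m₁ hU)
      (tendsto_measure_innerCyl m₂ hU) fun n => ?_
    rw [← ENNReal.toReal_le_toReal (measure_ne_top _ _) (measure_ne_top _ _)]
    change m₁.real _ ≤ m₂.real _
    rw [measureReal_innerCyl, measureReal_innerCyl]
    refine wordSum_le_wordSum fun w _ => ?_
    split_ifs
    · exact h w
    · exact le_rfl
  refine Measure.le_iff.2 fun B _ => ?_
  rw [Set.measure_eq_iInf_isOpen B m₂]
  refine le_iInf₂ fun U hU => le_iInf fun hUo => ?_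
  exact (measure_mono hU).trans (hopen U hUo)

theorem measure_eq_of_cylinder_eq {m₁ m₂ : Measure (Shift N)} [IsFiniteMeasure m₁]
    [IsFiniteMeasure m₂] (h : ∀ w, m₁.real (cylinder w) = m₂.real (cylinder w)) : m₁ = m₂ :=
  le_antisymm (measure_le_of_cylinder_le fun w => (h w).le)
    (measure_le_of_cylinder_le fun w => (h w).ge)

end Words

/-! ### Almost additive sequences -/

section AlmostAdditive

theorem subadditive_of_almostAdditive {u : ℕ → ℝ} {c : ℝ}
    (h : ∀ m n, |u (m + n) - u m - u n| ≤ c) : Subadditive (fun n => u n + c) := by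
  intro m n
  have := (abs_le.1 (h m n)).2
  dsimp only
  linarith

theorem bddBelow_of_almostAdditive {u : ℕ → ℝ} {c : ℝ}
    (h : ∀ m n, |u (m + n) - u m - u n| ≤ c) :
    BddBelow (Set.range fun n : ℕ => (u n + c) / n) := by
  have h1 : ∀ n : ℕ, n * (u 1 - c) ≤ u n + c := by
    intro n
    induction n with
    | zero =>
      have := (abs_le.1 (h 0 0)).2
      simp only [add_zero] at this
      push_cast
      linarith
    | succ n ih =>
      have := (abs_le.1 (h n 1)).1
      push_cast
      linarith
  -- The 0 takes care of n = 0, where the quotient has the default value 0.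
  refine ⟨min (u 1 - c) 0, ?_⟩
  rintro _ ⟨n, rfl⟩
  rcases Nat.eq_zero_or_pos n with rfl | hn
  · simp
  · refine (min_le_left _ _).trans ?_
    have hn' : (0 : ℝ) < n := by exact_mod_cast hn
    simp only
    rw [le_div_iff₀ hn', mul_comm]
    exact h1 n

theorem tendsto_div_of_tendsto_add_div {u : ℕ → ℝ} {c L : ℝ}
    (h : Tendsto (fun n : ℕ => (u n + c) / n) atTop (𝓝 L)) :
    Tendsto (fun n : ℕ => 1 / (n : ℝ) * u n) atTop (𝓝 L) := by
  have h2 : Tendsto (fun n : ℕ => c / (n : ℝ)) atTop (𝓝 0) :=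
    tendsto_const_div_atTop_nhds_zero_nat c
  have := h.sub h2
  rw [sub_zero] at this
  refine this.congr fun n => ?_
  ring

/-- An almost additive sequence stays at bounded distance from a linear one. -/
theorem exists_linear_of_almostAdditive {u : ℕ → ℝ} {c : ℝ}
    (h : ∀ m n, |u (m + n) - u m - u n| ≤ c) :
    ∃ L : ℝ, Tendsto (fun n : ℕ => 1 / (n : ℝ) * u n) atTop (𝓝 L) ∧
      ∀ n : ℕ, |u n - n * L| ≤ c := by
  have h' : ∀ m n, |(-u) (m + n) - (-u) m - (-u) n| ≤ c := by
    intro m n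
    rw [← abs_neg]
    convert h m n using 2
    simp only [Pi.neg_apply]
    ring
  -- Both u + c and -u + c are subadditive. By Fekete each limit is an infimum, and the two infima
  -- bound u n - nL from either side.
  have s1 := subadditive_of_almostAdditive h
  have b1 := bddBelow_of_almostAdditive h
  have s2 := subadditive_of_almostAdditive h'
  have b2 := bddBelow_of_almostAdditive h'
  have t1 := tendsto_div_of_tendsto_add_div (s1.tendsto_lim b1)
  have t2 := tendsto_div_of_tendsto_add_div (s2.tendsto_lim b2)
  have e : s2.lim = -s1.lim := by
    refine tendsto_nhds_unique t2 (t1.neg.congr fun n => ?_)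
    simp only [Pi.neg_apply]
    ring
  refine ⟨_, t1, fun n => ?_⟩
  rcases Nat.eq_zero_or_pos n with rfl | hn
  · have := h 0 0
    simp only [add_zero, sub_self, zero_sub, abs_neg] at this
    simpa using this
  · have hn' : (0 : ℝ) < n := by exact_mod_cast hn
    have l1 := s1.lim_le_div b1 hn.ne'
    have l2 := s2.lim_le_div b2 hn.ne'
    rw [e] at l2
    rw [le_div_iff₀ hn'] at l1 l2
    simp only [Pi.neg_apply] at l2
    rw [abs_le]
    constructor <;> linarith

end AlmostAdditive

/-! ### Almost multiplicative potentials -/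

section Potentials

variable {N : ℕ}

/-- A positive function of finite words whose logarithm is additive up to the error `K`. -/
structure AlmostMul (θ : List (Fin N) → ℝ) (K : ℝ) : Prop where
  pos : ∀ w, 0 < θ w
  abs_log_le : ∀ v w, |Real.log (θ (v ++ w)) - Real.log (θ v) - Real.log (θ w)| ≤ K

namespace AlmostMul

variable {θ θ' : List (Fin N) → ℝ} {K K' : ℝ}

theorem nonneg (h : AlmostMul θ K) : 0 ≤ K := (abs_nonneg _).trans (h.abs_log_le [] [])

theorem append_le (h : AlmostMul θ K) (v w : List (Fin N)) :
    θ (v ++ w) ≤ Real.exp K * (θ v * θ w) := by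
  have h1 := (abs_le.1 (h.abs_log_le v w)).2
  have hp := mul_pos (h.pos v) (h.pos w)
  rw [← Real.log_le_log_iff (h.pos _) (by positivity), Real.log_mul (Real.exp_ne_zero _) hp.ne',
    Real.log_exp, Real.log_mul (h.pos v).ne' (h.pos w).ne']
  linarith

theorem le_append (h : AlmostMul θ K) (v w : List (Fin N)) :
    θ v * θ w ≤ Real.exp K * θ (v ++ w) := by
  have h1 := (abs_le.1 (h.abs_log_le v w)).1
  have hp := mul_pos (h.pos v) (h.pos w)
  have := h.pos (v ++ w)
  rw [← Real.log_le_log_iff hp (by positivity),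
    Real.log_mul (Real.exp_ne_zero _) this.ne',
    Real.log_exp, Real.log_mul (h.pos v).ne' (h.pos w).ne']
  linarith

theorem of_le {C : ℝ} (hpos : ∀ w, 0 < θ w) (hC : 0 < C)
    (h1 : ∀ v w, θ (v ++ w) ≤ C * (θ v * θ w)) (h2 : ∀ v w, θ v * θ w ≤ C * θ (v ++ w)) :
    AlmostMul θ (Real.log C) where
  pos := hpos
  abs_log_le v w := by
    have a := Real.log_le_log (hpos _) (h1 v w)
    have b := Real.log_le_log (mul_pos (hpos v) (hpos w)) (h2 v w)
    rw [Real.log_mul hC.ne' (mul_pos (hpos v) (hpos w)).ne',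
      Real.log_mul (hpos _).ne' (hpos _).ne'] at a
    rw [Real.log_mul hC.ne' (hpos _).ne', Real.log_mul (hpos _).ne' (hpos _).ne'] at b
    rw [abs_le]
    constructor <;> linarith

theorem of_almostMultiplicative (hpos : ∀ w, 0 < θ w) (h : AlmostMultiplicative θ) :
    ∃ K, AlmostMul θ K := by
  obtain ⟨C, hC, h1, h2⟩ := h
  have hC' : 0 < C := by linarith
  refine ⟨Real.log C, of_le hpos hC' (fun v w => ?_) fun v w => ?_⟩
  · have := h1 v w
    dsimp only at this
    refine le_of_mul_le_mul_left ?_ hC'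
    linarith
  · have := h2 v w
    dsimp only at this
    rw [← mul_inv] at this
    have hv := hpos v
    have hw := hpos w
    have hvw := hpos (v ++ w)
    rw [inv_le_inv₀ (by positivity) (by positivity)] at this
    have := mul_le_mul_of_nonneg_left this (by positivity : 0 ≤ C * C)
    have e1 : C * C * (C⁻¹ * θ v * (C⁻¹ * θ w)) = θ v * θ w := by field_simp
    have e2 : C * C * (C⁻¹ * θ (v ++ w)) = C * θ (v ++ w) := by field_simp
    rwa [e1, e2] at this

theorem one : AlmostMul (fun _ : List (Fin N) => (1 : ℝ)) 0 where
  pos _ := one_pos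
  abs_log_le _ _ := by simp

theorem mul (h : AlmostMul θ K) (h' : AlmostMul θ' K') :
    AlmostMul (fun w => θ w * θ' w) (K + K') where
  pos w := mul_pos (h.pos w) (h'.pos w)
  abs_log_le v w := by
    simp only [fun w => Real.log_mul (h.pos w).ne' (h'.pos w).ne']
    refine le_trans (le_of_eq ?_)
      ((abs_add_le _ _).trans (add_le_add (h.abs_log_le v w) (h'.abs_log_le v w)))
    congr 1
    ring

theorem rpow (h : AlmostMul θ K) (p : ℝ) : AlmostMul (fun w => θ w ^ p) (|p| * K) where
  pos w := Real.rpow_pos_of_pos (h.pos w) p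
  abs_log_le v w := by
    simp only [fun w => Real.log_rpow (h.pos w)]
    rw [← mul_sub, ← mul_sub, abs_mul]
    exact mul_le_mul_of_nonneg_left (h.abs_log_le v w) (abs_nonneg _)

theorem inv (h : AlmostMul θ K) : AlmostMul (fun w => (θ w)⁻¹) K where
  pos w := inv_pos.2 (h.pos w)
  abs_log_le v w := by
    simp only [Real.log_inv]
    rw [← abs_neg]
    convert h.abs_log_le v w using 2
    ring

theorem mono (h : AlmostMul θ K) (hK : K ≤ K') : AlmostMul θ K' :=
  ⟨h.pos, fun v w => (h.abs_log_le v w).trans hK⟩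

/-! ### Pressure -/

section Pressure

theorem wordSum_add_le (h : AlmostMul θ K) (m n : ℕ) :
    wordSum (m + n) θ ≤ Real.exp K * (wordSum m θ * wordSum n θ) := by
  rw [wordSum_add, ← wordSum_mul_right, ← wordSum_mul_left]
  refine wordSum_le_wordSum fun u _ => ?_
  rw [← wordSum_mul_left, ← wordSum_mul_left]
  exact wordSum_le_wordSum fun v _ => h.append_le u v

theorem le_wordSum_add (h : AlmostMul θ K) (m n : ℕ) :
    wordSum m θ * wordSum n θ ≤ Real.exp K * wordSum (m + n) θ := by
  rw [wordSum_add, ← wordSum_mul_right, ← wordSum_mul_left]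
  refine wordSum_le_wordSum fun u _ => ?_
  rw [← wordSum_mul_left, ← wordSum_mul_left]
  exact wordSum_le_wordSum fun v _ => h.le_append u v

variable [NeZero N]

theorem wordSum_pos (h : AlmostMul θ K) (n : ℕ) : 0 < wordSum n θ := SelfAffine.wordSum_pos h.pos

theorem abs_log_wordSum_le (h : AlmostMul θ K) (m n : ℕ) :
    |Real.log (wordSum (m + n) θ) - Real.log (wordSum m θ) - Real.log (wordSum n θ)| ≤ K := by
  have a := Real.log_le_log (h.wordSum_pos _) (h.wordSum_add_le m n)
  have hm := h.wordSum_pos m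
  have hn := h.wordSum_pos n
  have b := Real.log_le_log (by positivity) (h.le_wordSum_add m n)
  rw [Real.log_mul (Real.exp_ne_zero _) (by positivity), Real.log_exp,
    Real.log_mul hm.ne' hn.ne'] at a
  rw [Real.log_mul (Real.exp_ne_zero _) (h.wordSum_pos _).ne', Real.log_exp,
    Real.log_mul hm.ne' hn.ne'] at b
  rw [abs_le]
  constructor <;> linarith

theorem tendsto_pressure (h : AlmostMul θ K) :
    Tendsto (fun n : ℕ => 1 / (n : ℝ) * Real.log (wordSum n θ)) atTop (𝓝 (pressure θ)) := by
  obtain ⟨L, hL, -⟩ := exists_linear_of_almostAdditive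
    (u := fun n => Real.log (wordSum n θ)) h.abs_log_wordSum_le
  exact tendsto_nhds_limUnder ⟨L, hL⟩

/-- The error is bounded uniformly in n, which is much more than the existence of the limit.
`IsGibbs.relEntropy_le` depends on this, as it does on the analogous bound for Λ. -/
theorem abs_log_wordSum_sub_le (h : AlmostMul θ K) (n : ℕ) :
    |Real.log (wordSum n θ) - n * pressure θ| ≤ K := by
  obtain ⟨L, hL, hL'⟩ := exists_linear_of_almostAdditive
    (u := fun n => Real.log (wordSum n θ)) h.abs_log_wordSum_le
  rw [tendsto_nhds_unique h.tendsto_pressure hL]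
  exact hL' n

end Pressure

/-! ### Lyapunov exponents of potentials -/

section Lam

variable {ν : Measure (Shift N)}

theorem wordSum_append_left (hν : IsInvariantProb ν) (m n : ℕ) (g : List (Fin N) → ℝ) :
    wordSum m (fun u => wordSum n (fun v => ν.real (cylinder (u ++ v)) * g u))
      = wordSum m (fun u => ν.real (cylinder u) * g u) := by
  have := hν.1
  refine wordSum_congr fun u _ => ?_
  rw [wordSum_mul_right, wordSum_cylinder_append_right]

theorem wordSum_append_right (hν : IsInvariantProb ν) (m n : ℕ) (g : List (Fin N) → ℝ) :
    wordSum m (fun u => wordSum n (fun v => ν.real (cylinder (u ++ v)) * g v))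
      = wordSum n (fun v => ν.real (cylinder v) * g v) := by
  have := hν.1
  rw [wordSum_comm]
  refine wordSum_congr fun v _ => ?_
  rw [wordSum_mul_right, wordSum_cylinder_append_left ν hν.2]

/-- Average the pointwise bound for a word u ++ v against ν: the prefix u is distributed by the
m-cylinders, and by invariance the suffix v by the n-cylinders. -/
theorem abs_wordSum_log_le (h : AlmostMul θ K) (hν : IsInvariantProb ν) (m n : ℕ) :
    |wordSum (m + n) (fun w => ν.real (cylinder w) * Real.log (θ w))
      - wordSum m (fun w => ν.real (cylinder w) * Real.log (θ w))
      - wordSum n (fun w => ν.real (cylinder w) * Real.log (θ w))| ≤ K := by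
  have := hν.1
  rw [← wordSum_append_left hν m n, ← wordSum_append_right hν m n, wordSum_add, ← wordSum_sub_fun,
    ← wordSum_sub_fun]
  simp only [← wordSum_sub_fun, ← mul_sub]
  have hK : wordSum m (fun u => wordSum n (fun v => ν.real (cylinder (u ++ v)) * K)) = K := by
    rw [← wordSum_add m n (fun w => ν.real (cylinder w) * K), wordSum_mul_right,
      wordSum_cylinder, one_mul]
  have hK' : wordSum m (fun u => wordSum n (fun v => ν.real (cylinder (u ++ v)) * (-K)))
      = -K := by
    rw [← wordSum_add m n (fun w => ν.real (cylinder w) * (-K)), wordSum_mul_right,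
      wordSum_cylinder, one_mul]
  rw [abs_le]
  constructor
  · rw [← hK']
    exact wordSum_le_wordSum fun u _ => wordSum_le_wordSum fun v _ =>
      mul_le_mul_of_nonneg_left (abs_le.1 (h.abs_log_le u v)).1 measureReal_nonneg
  · conv_rhs => rw [← hK]
    exact wordSum_le_wordSum fun u _ => wordSum_le_wordSum fun v _ =>
      mul_le_mul_of_nonneg_left (abs_le.1 (h.abs_log_le u v)).2 measureReal_nonneg

theorem exists_tendsto_Lam (h : AlmostMul θ K) (hν : IsInvariantProb ν) :
    ∃ L : ℝ, Tendsto (fun n : ℕ => 1 / (n : ℝ) * ∫ x, Real.log (θ (pre x n)) ∂ν) atTop (𝓝 L) ∧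
      ∀ n : ℕ, |wordSum n (fun w => ν.real (cylinder w) * Real.log (θ w)) - n * L| ≤ K := by
  have := hν.1
  obtain ⟨L, hL, hL'⟩ := exists_linear_of_almostAdditive
    (u := fun n => wordSum n (fun w => ν.real (cylinder w) * Real.log (θ w)))
    (h.abs_wordSum_log_le hν)
  refine ⟨L, ?_, hL'⟩
  simp only [integral_pre ν _ (fun w => Real.log (θ w))]
  exact hL

theorem tendsto_Lam (h : AlmostMul θ K) (hν : IsInvariantProb ν) :
    Tendsto (fun n : ℕ => 1 / (n : ℝ) * ∫ x, Real.log (θ (pre x n)) ∂ν) atTop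
      (𝓝 (Lam θ ν)) :=
  let ⟨L, hL, _⟩ := h.exists_tendsto_Lam hν
  tendsto_nhds_limUnder ⟨L, hL⟩

theorem abs_wordSum_log_sub_le (h : AlmostMul θ K) (hν : IsInvariantProb ν) (n : ℕ) :
    |wordSum n (fun w => ν.real (cylinder w) * Real.log (θ w)) - n * Lam θ ν| ≤ K := by
  obtain ⟨L, hL, hL'⟩ := h.exists_tendsto_Lam hν
  rw [tendsto_nhds_unique (h.tendsto_Lam hν) hL]
  exact hL' n

theorem tendsto_wordSum_log (h : AlmostMul θ K) (hν : IsInvariantProb ν) :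
    Tendsto (fun n : ℕ => 1 / (n : ℝ) * wordSum n (fun w => ν.real (cylinder w) *
      Real.log (θ w))) atTop (𝓝 (Lam θ ν)) := by
  have := hν.1
  have := h.tendsto_Lam hν
  simpa only [integral_pre ν _ (fun w => Real.log (θ w))] using this

theorem Lam_mul (h : AlmostMul θ K) (h' : AlmostMul θ' K') (hν : IsInvariantProb ν) :
    Lam (fun w => θ w * θ' w) ν = Lam θ ν + Lam θ' ν := by
  refine tendsto_nhds_unique ((h.mul h').tendsto_wordSum_log hν)
    (((h.tendsto_wordSum_log hν).add (h'.tendsto_wordSum_log hν)).congr fun n => ?_)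
  rw [← mul_add, ← wordSum_add_fun]
  simp only [fun w => Real.log_mul (h.pos w).ne' (h'.pos w).ne', mul_add]

theorem Lam_rpow (h : AlmostMul θ K) (p : ℝ) (hν : IsInvariantProb ν) :
    Lam (fun w => θ w ^ p) ν = p * Lam θ ν := by
  refine tendsto_nhds_unique ((h.rpow p).tendsto_wordSum_log hν)
    (((h.tendsto_wordSum_log hν).const_mul p).congr fun n => ?_)
  simp only [fun w => Real.log_rpow (h.pos w)]
  rw [← mul_assoc, mul_comm p, mul_assoc, ← wordSum_mul_left]
  congr 2
  funext w
  ring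

theorem Lam_le (h : AlmostMul θ K) (h' : AlmostMul θ' K') (hν : IsInvariantProb ν) {a : ℝ}
    (hle : ∀ w, Real.log (θ' w) ≤ Real.log (θ w) + w.length * a) :
    Lam θ' ν ≤ Lam θ ν + a := by
  have := hν.1
  refine le_of_tendsto_of_tendsto (h'.tendsto_wordSum_log hν)
    ((h.tendsto_wordSum_log hν).add_const a) ?_
  filter_upwards [eventually_gt_atTop 0] with n hn
  have hn' : (0 : ℝ) < n := by exact_mod_cast hn
  have : wordSum n (fun w => ν.real (cylinder w) * Real.log (θ' w))
      ≤ wordSum n (fun w => ν.real (cylinder w) * Real.log (θ w)) + n * a := by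
    calc _ ≤ wordSum n (fun w => ν.real (cylinder w) * Real.log (θ w)
              + ν.real (cylinder w) * (n * a)) := by
          refine wordSum_le_wordSum fun w hw => ?_
          rw [← mul_add, ← hw]
          exact mul_le_mul_of_nonneg_left (hle w) measureReal_nonneg
      _ = _ := by rw [wordSum_add_fun, wordSum_mul_right, wordSum_cylinder, one_mul]
  calc _ ≤ 1 / (n : ℝ) * (wordSum n (fun w => ν.real (cylinder w) * Real.log (θ w)) + n * a) :=
        mul_le_mul_of_nonneg_left this (by positivity)
    _ = _ := by field_simp

end Lam

end AlmostMul

/-! ### Entropy and the variational inequality -/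

section Entropy

variable {ν : Measure (Shift N)}

/-- This is log x ≤ x - 1 at x = q / p. It is the termwise form of the nonnegativity of relative
entropy. The condition on q = 0 excludes the default value log 0 = 0. -/
theorem mul_log_sub_log_le {p q : ℝ} (hp : 0 ≤ p) (hq : 0 ≤ q) (h : q = 0 → p = 0) :
    p * (Real.log q - Real.log p) ≤ q - p := by
  rcases hp.eq_or_lt with rfl | hp
  · simpa using hq
  · have hq' : 0 < q := hq.lt_of_ne fun e => hp.ne' (h e.symm)
    rw [← Real.log_div hq'.ne' hp.ne']
    calc p * Real.log (q / p) ≤ p * (q / p - 1) :=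
          mul_le_mul_of_nonneg_left (Real.log_le_sub_one_of_pos (by positivity)) hp.le
      _ = q - p := by field_simp

/-- The entropy of the partition of `Shift N` into cylinders of length `n`. -/
noncomputable def blockEntropy (ν : Measure (Shift N)) (n : ℕ) : ℝ :=
  -wordSum n (fun w => ν.real (cylinder w) * Real.log (ν.real (cylinder w)))

theorem cylinder_append_real_le (ν : Measure (Shift N)) [IsFiniteMeasure ν] (u v : List (Fin N)) :
    ν.real (cylinder (u ++ v)) ≤ ν.real (cylinder u) := by
  rw [cylinder_append]
  exact measureReal_mono Set.inter_subset_left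

theorem cylinder_append_real_le_right (hν : IsInvariantProb ν) (u v : List (Fin N)) :
    ν.real (cylinder (u ++ v)) ≤ ν.real (cylinder v) := by
  have := hν.1
  rw [cylinder_append, ← (hν.2.iterate u.length).measureReal_preimage
    (measurableSet_cylinder v).nullMeasurableSet]
  exact measureReal_mono Set.inter_subset_right

/-- The joint law of prefix and suffix has nonnegative relative entropy with respect to the product
of its marginals. -/
theorem subadditive_blockEntropy (hν : IsInvariantProb ν) : Subadditive (blockEntropy ν) := by
  have := hν.1
  intro m n
  unfold blockEntropy
  have key : wordSum m (fun u => wordSum n (fun v => ν.real (cylinder (u ++ v)) *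
        (Real.log (ν.real (cylinder u)) + Real.log (ν.real (cylinder v))
          - Real.log (ν.real (cylinder (u ++ v))))))
      ≤ wordSum m (fun u => wordSum n (fun v =>
        ν.real (cylinder u) * ν.real (cylinder v) - ν.real (cylinder (u ++ v)))) := by
    refine wordSum_le_wordSum fun u _ => wordSum_le_wordSum fun v _ => ?_
    have hu := cylinder_append_real_le ν u v
    have hv := cylinder_append_real_le_right hν u v
    have h0 : 0 ≤ ν.real (cylinder (u ++ v)) := measureReal_nonneg
    rcases h0.eq_or_lt with h0 | h0
    · rw [← h0]
      have : 0 ≤ ν.real (cylinder u) * ν.real (cylinder v) := by positivity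
      simpa using this
    · rw [← Real.log_mul (h0.trans_le hu).ne' (h0.trans_le hv).ne']
      refine mul_log_sub_log_le h0.le (by positivity) fun e => ?_
      exact absurd e (mul_pos (h0.trans_le hu) (h0.trans_le hv)).ne'
  have e1 : wordSum m (fun u => wordSum n (fun v =>
        ν.real (cylinder u) * ν.real (cylinder v) - ν.real (cylinder (u ++ v)))) = 0 := by
    simp only [wordSum_sub_fun, wordSum_mul_left, wordSum_cylinder, mul_one,
      wordSum_cylinder_append_right, sub_self]
    simp [wordSum]
  rw [e1] at key
  simp only [mul_sub, mul_add, wordSum_sub_fun, wordSum_add_fun] at key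
  rw [AlmostMul.wordSum_append_left hν m n (fun w => Real.log (ν.real (cylinder w))),
    AlmostMul.wordSum_append_right hν m n (fun w => Real.log (ν.real (cylinder w))),
    ← wordSum_add m n (fun w => ν.real (cylinder w) * Real.log (ν.real (cylinder w)))] at key
  linarith

theorem blockEntropy_nonneg (ν : Measure (Shift N)) [IsProbabilityMeasure ν] (n : ℕ) :
    0 ≤ blockEntropy ν n := by
  unfold blockEntropy wordSum
  rw [← Finset.sum_neg_distrib]
  exact Finset.sum_nonneg fun w _ => by
    have := Real.mul_log_nonpos (x := ν.real (cylinder (List.ofFn w))) measureReal_nonneg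
      measureReal_le_one
    linarith

theorem bddBelow_blockEntropy (ν : Measure (Shift N)) [IsProbabilityMeasure ν] :
    BddBelow (Set.range fun n : ℕ => blockEntropy ν n / n) :=
  ⟨0, by
    rintro _ ⟨n, rfl⟩
    exact div_nonneg (blockEntropy_nonneg ν n) n.cast_nonneg⟩

theorem tendsto_entropy (hν : IsInvariantProb ν) :
    Tendsto (fun n : ℕ => 1 / (n : ℝ) * blockEntropy ν n) atTop (𝓝 (entropy ν)) := by
  have := hν.1
  have h := (subadditive_blockEntropy hν).tendsto_lim (bddBelow_blockEntropy ν)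
  have h2 : Tendsto (fun n : ℕ => 1 / (n : ℝ) * blockEntropy ν n) atTop
      (𝓝 (subadditive_blockEntropy hν).lim) := h.congr fun n => by ring
  unfold entropy
  simp only [blockEntropy, mul_neg] at h2 ⊢
  exact tendsto_nhds_limUnder ⟨_, h2⟩

theorem mul_entropy_le (hν : IsInvariantProb ν) (n : ℕ) :
    n * entropy ν ≤ blockEntropy ν n := by
  have := hν.1
  have h := (subadditive_blockEntropy hν).tendsto_lim (bddBelow_blockEntropy ν)
  have e : entropy ν = (subadditive_blockEntropy hν).lim :=
    tendsto_nhds_unique (tendsto_entropy hν) (h.congr fun n => by ring)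
  rcases Nat.eq_zero_or_pos n with rfl | hn
  · simpa using blockEntropy_nonneg ν 0
  · have := (subadditive_blockEntropy hν).lim_le_div (bddBelow_blockEntropy ν) hn.ne'
    rw [← e, le_div_iff₀ (by exact_mod_cast hn)] at this
    linarith

/-- Nonnegativity of the relative entropy of ν with respect to the normalised weights θ / ∑ θ on
words of length n. -/
theorem blockEntropy_add_le_log [NeZero N] (ν : Measure (Shift N)) [IsProbabilityMeasure ν]
    {θ : List (Fin N) → ℝ} (hθ : ∀ w, 0 < θ w) (n : ℕ) :
    blockEntropy ν n + wordSum n (fun w => ν.real (cylinder w) * Real.log (θ w))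
      ≤ Real.log (wordSum n θ) := by
  have hZ : 0 < wordSum n θ := wordSum_pos hθ
  have key : wordSum n (fun w => ν.real (cylinder w) *
      (Real.log (θ w * (wordSum n θ)⁻¹) - Real.log (ν.real (cylinder w))))
      ≤ wordSum n (fun w => θ w * (wordSum n θ)⁻¹ - ν.real (cylinder w)) := by
    refine wordSum_le_wordSum fun w _ => ?_
    have := mul_pos (hθ w) (inv_pos.2 hZ)
    exact mul_log_sub_log_le measureReal_nonneg this.le fun e => absurd e this.ne'
  rw [wordSum_sub_fun, wordSum_mul_right, mul_inv_cancel₀ hZ.ne', wordSum_cylinder,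
    sub_self] at key
  simp only [fun w => Real.log_mul (hθ w).ne' (inv_pos.2 hZ).ne', Real.log_inv, mul_sub,
    mul_add, wordSum_sub_fun, wordSum_add_fun, wordSum_mul_right, wordSum_cylinder] at key
  unfold blockEntropy
  linarith

theorem AlmostMul.entropy_add_Lam_le [NeZero N] {θ : List (Fin N) → ℝ} {K : ℝ}
    (h : AlmostMul θ K) (hν : IsInvariantProb ν) : entropy ν + Lam θ ν ≤ pressure θ := by
  have := hν.1
  refine le_of_tendsto_of_tendsto' ((tendsto_entropy hν).add (h.tendsto_wordSum_log hν))
    h.tendsto_pressure fun n => ?_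
  rw [← mul_add]
  exact mul_le_mul_of_nonneg_left (blockEntropy_add_le_log ν h.pos n) (by positivity)

end Entropy

end Potentials

/-! ### Gibbs states: existence, ergodicity, uniqueness -/

section Gibbs

variable {N : ℕ}

/-- The probability measures on a compact metrisable space are weakly compact, so every ultrafilter
has a limit and no subsequence is needed. Clopen sets have empty frontier, hence weak convergence is
convergence on them. -/
theorem exists_tendsto_ultrafilter {ι : Type*} (U : Ultrafilter ι) (M : ι → Measure (Shift N))
    (hM : ∀ i, IsProbabilityMeasure (M i)) :
    ∃ ν : Measure (Shift N), IsProbabilityMeasure ν ∧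
      ∀ B, IsClopen B → Tendsto (fun i => (M i).real B) U (𝓝 (ν.real B)) := by
  let M' : ι → ProbabilityMeasure (Shift N) := fun i => ⟨M i, hM i⟩
  obtain ⟨ν, -, hν⟩ := isCompact_univ.ultrafilter_le_nhds (U.map M') (by simp)
  refine ⟨ν, inferInstance, fun B hB => ?_⟩
  have hν' : Tendsto M' U (𝓝 ν) := hν
  have := ProbabilityMeasure.tendsto_measure_of_null_frontier_of_tendsto' hν' (E := B)
    (by simp [hB.frontier_eq])
  exact (ENNReal.tendsto_toReal (measure_ne_top _ _)).comp this

/-- The invariant measures whose cylinder weights are comparable to the normalised potential. -/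
structure IsGibbs (θ : List (Fin N) → ℝ) (C : ℝ) (ν : Measure (Shift N)) : Prop where
  inv : IsInvariantProb ν
  le : ∀ w, wordSum w.length θ * ν.real (cylinder w) ≤ C * θ w
  ge : ∀ w, θ w ≤ C * (wordSum w.length θ * ν.real (cylinder w))

/-- A finite word followed by zeros. -/
def padWord [NeZero N] (w : List (Fin N)) : Shift N := fun k => w.getD k 0

theorem pre_padWord_append [NeZero N] (w z : List (Fin N)) :
    pre (padWord (w ++ z)) w.length = w := by
  refine List.ext_getElem (by simp) fun i h1 h2 => ?_
  simp only [pre, List.getElem_ofFn, padWord]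
  simp [List.getElem?_append, h2]

/-- The atomic measure with weights `p w` on the words of length `n`. -/
noncomputable def wordMeasure [NeZero N] (n : ℕ) (p : List (Fin N) → ℝ) : Measure (Shift N) :=
  ∑ f : Fin n → Fin N, ENNReal.ofReal (p (List.ofFn f)) • Measure.dirac (padWord (List.ofFn f))

theorem wordMeasure_real [NeZero N] {n : ℕ} {p : List (Fin N) → ℝ} (hp : ∀ w, 0 ≤ p w)
    {B : Set (Shift N)} (hB : MeasurableSet B) :
    (wordMeasure n p).real B = wordSum n (fun w => p w * B.indicator 1 (padWord w)) := by
  unfold wordMeasure wordSum Measure.real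
  rw [Measure.finsetSum_apply, ENNReal.toReal_sum]
  · refine Finset.sum_congr rfl fun f _ => ?_
    rw [Measure.smul_apply, Measure.dirac_apply' _ hB, smul_eq_mul, ENNReal.toReal_mul,
      ENNReal.toReal_ofReal (hp _)]
    by_cases h : padWord (List.ofFn f) ∈ B <;> simp [h]
  · intro f _
    rw [Measure.smul_apply, Measure.dirac_apply' _ hB, smul_eq_mul]
    by_cases h : padWord (List.ofFn f) ∈ B <;> simp [h]

theorem isProbabilityMeasure_wordMeasure [NeZero N] {n : ℕ} {p : List (Fin N) → ℝ}
    (hp : ∀ w, 0 ≤ p w) (h1 : wordSum n p = 1) : IsProbabilityMeasure (wordMeasure n p) := by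
  refine ⟨?_⟩
  have := wordMeasure_real (n := n) hp MeasurableSet.univ
  simp only [Set.indicator_univ, Pi.one_apply, mul_one, h1] at this
  exact (ENNReal.toReal_eq_one_iff _).1 this

/-- The window from k to k + |w| lies inside the sampled word, so the padding by zeros plays no
role. -/
theorem wordMeasure_real_preimage_cylinder [NeZero N] {k j : ℕ} {p : List (Fin N) → ℝ}
    (hp : ∀ w, 0 ≤ p w) (w : List (Fin N)) :
    (wordMeasure (k + (w.length + j)) p).real (leftShift^[k] ⁻¹' cylinder w)
      = wordSum k (fun u => wordSum j (fun z => p (u ++ (w ++ z)))) := by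
  rw [wordMeasure_real hp ((measurable_leftShift.iterate k) (measurableSet_cylinder w)),
    wordSum_add]
  refine wordSum_congr fun u hu => ?_
  rw [wordSum_add]
  conv_rhs => rw [← wordSum_ite_eq (w := w) (fun v => wordSum j fun z => p (u ++ (v ++ z)))]
  refine wordSum_congr fun v hv => ?_
  have : ∀ z, padWord (u ++ (v ++ z)) ∈ leftShift^[k] ⁻¹' cylinder w ↔ v = w := by
    intro z
    have h := pre_padWord_append (u ++ v) z
    rw [List.length_append, pre_add, List.append_assoc] at h
    have h' := (List.append_inj h (by simp)).2
    rw [Set.mem_preimage, mem_cylinder_iff hv.symm, ← hu, h']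
  split_ifs with hvw
  · exact wordSum_congr fun z _ => by simp [(this z).2 hvw]
  · rw [wordSum_congr (θ' := fun _ => 0) fun z _ => by
      rw [Set.indicator_of_notMem fun h => hvw ((this z).1 h), mul_zero]]
    simp [wordSum]

namespace AlmostMul

variable {θ : List (Fin N) → ℝ} {K : ℝ}

/-- Of the four factors exp K, two come from splitting θ (u ++ (w ++ z)) and two from splitting the
word sum of length k + (|w| + j). -/
theorem wordSum_sandwich_le (h : AlmostMul θ K) (k j : ℕ) (w : List (Fin N)) :
    wordSum w.length θ * wordSum k (fun u => wordSum j (fun z => θ (u ++ (w ++ z))))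
      ≤ Real.exp (4 * K) * (wordSum (k + (w.length + j)) θ * θ w) := by
  have h0 : ∀ n, 0 ≤ wordSum n θ := fun n => SelfAffine.wordSum_nonneg fun w => (h.pos w).le
  have hE := Real.exp_pos K
  calc wordSum w.length θ * wordSum k (fun u => wordSum j (fun z => θ (u ++ (w ++ z))))
      ≤ wordSum w.length θ * wordSum k (fun u => wordSum j (fun z =>
          θ u * (Real.exp K * (Real.exp K * θ w) * θ z))) := by
        refine mul_le_mul_of_nonneg_left (wordSum_le_wordSum fun u _ =>
          wordSum_le_wordSum fun z _ => ?_) (h0 _)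
        calc _ ≤ Real.exp K * (θ u * θ (w ++ z)) := h.append_le _ _
          _ ≤ Real.exp K * (θ u * (Real.exp K * (θ w * θ z))) := by
            have := (h.pos u).le
            gcongr
            exact h.append_le _ _
          _ = _ := by ring
    _ = Real.exp K * Real.exp K * θ w *
        (wordSum k θ * (wordSum w.length θ * wordSum j θ)) := by
        simp only [wordSum_mul_left, wordSum_mul_right]
        ring
    _ ≤ Real.exp K * Real.exp K * θ w * (wordSum k θ *
          (Real.exp K * wordSum (w.length + j) θ)) := by
        have := (h.pos w).le
        exact mul_le_mul_of_nonneg_left (mul_le_mul_of_nonneg_left (h.le_wordSum_add _ _) (h0 k))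
          (by positivity)
    _ = Real.exp K * Real.exp K * Real.exp K * θ w *
          (wordSum k θ * wordSum (w.length + j) θ) := by ring
    _ ≤ Real.exp K * Real.exp K * Real.exp K * θ w *
          (Real.exp K * wordSum (k + (w.length + j)) θ) := by
        have := (h.pos w).le
        exact mul_le_mul_of_nonneg_left (h.le_wordSum_add _ _) (by positivity)
    _ = Real.exp (4 * K) * (wordSum (k + (w.length + j)) θ * θ w) := by
        rw [show 4 * K = K + K + K + K by ring, Real.exp_add, Real.exp_add, Real.exp_add]
        ring

theorem le_wordSum_sandwich (h : AlmostMul θ K) (k j : ℕ) (w : List (Fin N)) :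
    wordSum (k + (w.length + j)) θ * θ w ≤ Real.exp (4 * K) * (wordSum w.length θ *
      wordSum k (fun u => wordSum j (fun z => θ (u ++ (w ++ z))))) := by
  have h0 : ∀ n, 0 ≤ wordSum n θ := fun n => SelfAffine.wordSum_nonneg fun w => (h.pos w).le
  have hE := Real.exp_pos K
  have hw := (h.pos w).le
  calc wordSum (k + (w.length + j)) θ * θ w
      ≤ Real.exp K * (wordSum k θ * wordSum (w.length + j) θ) * θ w := by
        gcongr
        exact h.wordSum_add_le _ _
    _ ≤ Real.exp K * (wordSum k θ * (Real.exp K * (wordSum w.length θ * wordSum j θ))) * θ w := by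
        have := h0 k
        gcongr
        exact h.wordSum_add_le _ _
    _ = Real.exp K * Real.exp K * wordSum w.length θ *
        wordSum k (fun u => wordSum j (fun z => θ u * (θ w * θ z))) := by
        simp only [wordSum_mul_left, wordSum_mul_right]
        ring
    _ ≤ Real.exp K * Real.exp K * wordSum w.length θ * wordSum k (fun u => wordSum j (fun z =>
          Real.exp K * (Real.exp K * θ (u ++ (w ++ z))))) := by
        refine mul_le_mul_of_nonneg_left (wordSum_le_wordSum fun u _ =>
          wordSum_le_wordSum fun z _ => ?_) (by have := h0 w.length; positivity)
        calc θ u * (θ w * θ z) ≤ θ u * (Real.exp K * θ (w ++ z)) := by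
              exact mul_le_mul_of_nonneg_left (h.le_append _ _) (h.pos u).le
          _ = Real.exp K * (θ u * θ (w ++ z)) := by ring
          _ ≤ _ := mul_le_mul_of_nonneg_left (h.le_append _ _) hE.le
    _ = _ := by
        simp only [wordSum_mul_left]
        rw [show 4 * K = K + K + K + K by ring, Real.exp_add, Real.exp_add, Real.exp_add]
        ring

end AlmostMul

/-- The average of the first `n` shifts of a measure. -/
noncomputable def cesaro (n : ℕ) (ρ : Measure (Shift N)) : Measure (Shift N) :=
  (n : ENNReal)⁻¹ • ∑ k ∈ Finset.range n, ρ.map leftShift^[k]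

theorem cesaro_real (n : ℕ) (ρ : Measure (Shift N)) [IsProbabilityMeasure ρ] {B : Set (Shift N)}
    (hB : MeasurableSet B) :
    (cesaro n ρ).real B = (n : ℝ)⁻¹ * ∑ k ∈ Finset.range n, ρ.real (leftShift^[k] ⁻¹' B) := by
  unfold cesaro Measure.real
  rw [Measure.smul_apply, Measure.finsetSum_apply, smul_eq_mul, ENNReal.toReal_mul,
    ENNReal.toReal_sum]
  · simp only [ENNReal.toReal_inv, ENNReal.toReal_natCast]
    congr 1
    refine Finset.sum_congr rfl fun k _ => ?_
    rw [Measure.map_apply (measurable_leftShift.iterate k) hB]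
  · intro k _
    rw [Measure.map_apply (measurable_leftShift.iterate k) hB]
    exact measure_ne_top _ _

theorem isProbabilityMeasure_cesaro {n : ℕ} (hn : n ≠ 0) (ρ : Measure (Shift N))
    [IsProbabilityMeasure ρ] : IsProbabilityMeasure (cesaro n ρ) := by
  refine ⟨?_⟩
  have := cesaro_real n ρ MeasurableSet.univ
  simp only [Set.preimage_univ, probReal_univ, Finset.sum_const, Finset.card_range, nsmul_eq_mul,
    mul_one] at this
  rw [inv_mul_cancel₀ (by exact_mod_cast hn)] at this
  exact (ENNReal.toReal_eq_one_iff _).1 this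

/-- The difference of the two averages telescopes to its two end terms, both in [0, 1]. -/
theorem abs_cesaro_preimage_sub_le (n : ℕ) (ρ : Measure (Shift N)) [IsProbabilityMeasure ρ]
    {B : Set (Shift N)} (hB : MeasurableSet B) :
    |(cesaro n ρ).real (leftShift ⁻¹' B) - (cesaro n ρ).real B| ≤ (n : ℝ)⁻¹ := by
  rw [cesaro_real n ρ hB, cesaro_real n ρ (measurable_leftShift hB), ← mul_sub,
    ← Finset.sum_sub_distrib]
  have : ∀ k, ρ.real (leftShift^[k] ⁻¹' (leftShift ⁻¹' B)) - ρ.real (leftShift^[k] ⁻¹' B)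
      = ρ.real (leftShift^[k + 1] ⁻¹' B) - ρ.real (leftShift^[k] ⁻¹' B) := by
    intro k
    rw [← Set.preimage_comp, Function.iterate_succ']
  rw [Finset.sum_congr rfl fun k _ => this k, Finset.sum_range_sub (fun k =>
    ρ.real (leftShift^[k] ⁻¹' B)), abs_mul, abs_of_nonneg (by positivity : (0 : ℝ) ≤ (n : ℝ)⁻¹)]
  refine mul_le_of_le_one_right (by positivity) ?_
  have h1 : ρ.real (leftShift^[n] ⁻¹' B) ≤ 1 := measureReal_le_one
  have h2 : ρ.real (leftShift^[0] ⁻¹' B) ≤ 1 := measureReal_le_one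
  have h3 : 0 ≤ ρ.real (leftShift^[n] ⁻¹' B) := measureReal_nonneg
  have h4 : 0 ≤ ρ.real (leftShift^[0] ⁻¹' B) := measureReal_nonneg
  rw [abs_le]
  constructor <;> linarith

/-- Give the words of a large length the normalised weights θ and average over shifts. The sandwich
estimates give the Gibbs bounds for each single shift with the same constant, hence for the averages
and for their limit; averaging makes the limit invariant. -/
theorem AlmostMul.exists_isGibbs [NeZero N] {θ : List (Fin N) → ℝ} {K : ℝ}
    (h : AlmostMul θ K) : ∃ ν, IsGibbs θ (Real.exp (4 * K)) ν := by
  have hZ := h.wordSum_pos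
  let p : ℕ → List (Fin N) → ℝ := fun n w => θ w * (wordSum n θ)⁻¹
  have hp : ∀ n w, 0 ≤ p n w := fun n w =>
    mul_nonneg (h.pos w).le (inv_nonneg.2 (hZ n).le)
  let ρ : ℕ → Measure (Shift N) := fun n => wordMeasure n (p n)
  have hρ : ∀ n, IsProbabilityMeasure (ρ n) := fun n =>
    isProbabilityMeasure_wordMeasure (hp n) (by
      simp only [p, wordSum_mul_right, mul_inv_cancel₀ (hZ n).ne'])
  -- The words are twice as long as the number of shifts, so that for |w| ≤ n + 1 every shifted
  -- window for w still fits into the word.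
  let M : ℕ → Measure (Shift N) := fun n => cesaro (n + 1) (ρ (2 * (n + 1)))
  obtain ⟨ν, hν, hlim⟩ := exists_tendsto_ultrafilter (hyperfilter ℕ) M
    fun n => isProbabilityMeasure_cesaro n.succ_ne_zero _
  have hle : (hyperfilter ℕ : Filter ℕ) ≤ atTop := Nat.hyperfilter_le_atTop
  have hterm : ∀ (w : List (Fin N)) (n k : ℕ), w.length ≤ n + 1 → k < n + 1 →
      ∃ j, k + (w.length + j) = 2 * (n + 1) ∧
        wordSum (2 * (n + 1)) θ * (ρ (2 * (n + 1))).real (leftShift^[k] ⁻¹' cylinder w)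
        = wordSum k (fun u => wordSum j (fun z => θ (u ++ (w ++ z)))) := by
    intro w n k hw hk
    obtain ⟨j, hj⟩ := Nat.exists_eq_add_of_le (show k + w.length ≤ 2 * (n + 1) by omega)
    refine ⟨j, by omega, ?_⟩
    have e : 2 * (n + 1) = k + (w.length + j) := by omega
    have := wordMeasure_real_preimage_cylinder (k := k) (j := j) (hp (2 * (n + 1))) w
    rw [← e] at this
    simp only [ρ, this, p, wordSum_mul_right]
    field_simp [(hZ (2 * (n + 1))).ne']
  have hM : ∀ (w : List (Fin N)) (n : ℕ) (c : ℝ),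
      ((∀ k < n + 1, c ≤ (ρ (2 * (n + 1))).real (leftShift^[k] ⁻¹' cylinder w)) →
        c ≤ (M n).real (cylinder w)) ∧
      ((∀ k < n + 1, (ρ (2 * (n + 1))).real (leftShift^[k] ⁻¹' cylinder w) ≤ c) →
        (M n).real (cylinder w) ≤ c) := by
    intro w n c
    simp only [M, cesaro_real _ _ (measurableSet_cylinder w)]
    have hn : (0 : ℝ) < ((n + 1 : ℕ) : ℝ) := by positivity
    rw [inv_mul_eq_div]
    constructor
    · intro hc
      rw [le_div_iff₀ hn]
      have := Finset.card_nsmul_le_sum (Finset.range (n + 1)) _ c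
        fun k hk => hc k (Finset.mem_range.1 hk)
      simpa [mul_comm] using this
    · intro hc
      rw [div_le_iff₀ hn]
      have := Finset.sum_le_card_nsmul (Finset.range (n + 1)) _ c
        fun k hk => hc k (Finset.mem_range.1 hk)
      simpa [mul_comm] using this
  refine ⟨ν, ⟨hν, measurable_leftShift, ?_⟩, fun w => ?_, fun w => ?_⟩
  · have : IsProbabilityMeasure (ν.map leftShift) :=
      Measure.isProbabilityMeasure_map measurable_leftShift.aemeasurable
    refine measure_eq_of_cylinder_eq fun w => ?_
    rw [map_measureReal_apply measurable_leftShift (measurableSet_cylinder w)]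
    have t1 := (hlim _ ((isClopen_cylinder w).preimage continuous_leftShift)).sub
      (hlim _ (isClopen_cylinder w))
    have t2 : Tendsto (fun n => (M n).real (leftShift ⁻¹' cylinder w) - (M n).real (cylinder w))
        (hyperfilter ℕ : Filter ℕ) (𝓝 0) := by
      refine squeeze_zero_norm (fun n => ?_)
        (((tendsto_inv_atTop_nhds_zero_nat (𝕜 := ℝ)).comp (tendsto_add_atTop_nat 1)).mono_left hle)
      exact abs_cesaro_preimage_sub_le _ _ (measurableSet_cylinder w)
    exact sub_eq_zero.1 (tendsto_nhds_unique t1 t2)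
  · rw [mul_comm, ← le_div_iff₀ (hZ _)]
    refine le_of_tendsto (hlim _ (isClopen_cylinder w)) ?_
    filter_upwards [hle (eventually_ge_atTop w.length)] with n hn
    have hn : w.length ≤ n := hn
    refine (hM w n _).2 fun k hk => ?_
    obtain ⟨j, hj, e⟩ := hterm w n k (by omega) hk
    have := h.wordSum_sandwich_le k j w
    rw [← e, hj] at this
    rw [le_div_iff₀ (hZ _)]
    refine le_of_mul_le_mul_left ?_ (hZ (2 * (n + 1)))
    linarith
  · rw [← div_le_iff₀' (Real.exp_pos _), ← div_le_iff₀' (hZ _)]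
    refine ge_of_tendsto (hlim _ (isClopen_cylinder w)) ?_
    filter_upwards [hle (eventually_ge_atTop w.length)] with n hn
    have hn : w.length ≤ n := hn
    refine (hM w n _).1 fun k hk => ?_
    obtain ⟨j, hj, e⟩ := hterm w n k (by omega) hk
    have := h.le_wordSum_sandwich k j w
    rw [← e, hj] at this
    rw [div_le_iff₀' (hZ _), div_le_iff₀' (Real.exp_pos _)]
    refine le_of_mul_le_mul_left ?_ (hZ (2 * (n + 1)))
    linarith

namespace IsGibbs

variable {θ : List (Fin N) → ℝ} {K C : ℝ} {ν η : Measure (Shift N)}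

theorem const_pos [NeZero N] (hν : IsGibbs θ C ν) (h : AlmostMul θ K) : 0 < C := by
  by_contra! hC
  have h1 := hν.ge []
  have h2 : 0 ≤ wordSum ([] : List (Fin N)).length θ * ν.real (cylinder []) :=
    mul_nonneg (h.wordSum_pos _).le measureReal_nonneg
  linarith [h.pos [], mul_nonpos_of_nonpos_of_nonneg hC h2]

theorem real_pos [NeZero N] (hν : IsGibbs θ C ν) (h : AlmostMul θ K) (w : List (Fin N)) :
    0 < ν.real (cylinder w) := by
  by_contra! h0
  have e : ν.real (cylinder w) = 0 := le_antisymm h0 measureReal_nonneg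
  have := hν.ge w
  rw [e, mul_zero, mul_zero] at this
  exact absurd (h.pos w) this.not_gt

/-- Half of the quasi-Bernoulli property, and the form of independence from which ergodicity
follows. The three Gibbs bounds used give C ^ 3, the splittings of θ and of the word sum give exp (2
K). -/
theorem mul_le [NeZero N] (hν : IsGibbs θ C ν) (h : AlmostMul θ K) (u v : List (Fin N)) :
    ν.real (cylinder u) * ν.real (cylinder v)
      ≤ C ^ 3 * Real.exp (2 * K) * ν.real (cylinder (u ++ v)) := by
  have hC := hν.const_pos h
  have hZu := h.wordSum_pos u.length
  have hZv := h.wordSum_pos v.length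
  refine le_of_mul_le_mul_left ?_ (mul_pos hZu hZv)
  calc wordSum u.length θ * wordSum v.length θ * (ν.real (cylinder u) * ν.real (cylinder v))
      = (wordSum u.length θ * ν.real (cylinder u)) *
          (wordSum v.length θ * ν.real (cylinder v)) := by ring
    _ ≤ (C * θ u) * (C * θ v) := by
        have := h.pos u
        exact mul_le_mul (hν.le u) (hν.le v) (by positivity) (by positivity)
    _ = C ^ 2 * (θ u * θ v) := by ring
    _ ≤ C ^ 2 * (Real.exp K * θ (u ++ v)) := by
        exact mul_le_mul_of_nonneg_left (h.le_append u v) (by positivity)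
    _ ≤ C ^ 2 * (Real.exp K * (C * (wordSum (u ++ v).length θ * ν.real (cylinder (u ++ v))))) := by
        gcongr; exact hν.ge _
    _ ≤ C ^ 2 * (Real.exp K * (C * ((Real.exp K * (wordSum u.length θ * wordSum v.length θ)) *
          ν.real (cylinder (u ++ v))))) := by
        gcongr
        rw [List.length_append]
        exact h.wordSum_add_le _ _
    _ = _ := by
        rw [show 2 * K = K + K by ring, Real.exp_add]
        ring

/-- The inequality `mul_le` between cylinders extends to Borel sets in the second factor, and
applied to an invariant set E it says that E fills a fixed proportion of every cylinder. Extending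
in the first factor as well yields ν(E) ν(B) ≤ κ ν(B ∩ E) for all Borel B. -/
theorem ergodic [NeZero N] (hν : IsGibbs θ C ν) (h : AlmostMul θ K) : Ergodic leftShift ν := by
  have hprob := hν.inv.1
  refine ⟨hν.inv.2, ⟨fun {E} hE hinv => ?_⟩⟩
  have hC := hν.const_pos h
  set κ := C ^ 3 * Real.exp (2 * K) with hκ
  have hκ0 : 0 ≤ κ := by positivity
  have hiter : ∀ n, leftShift^[n] ⁻¹' E = E := by
    intro n
    induction n with
    | zero => rfl
    | succ n ih => rw [Function.iterate_succ', Set.preimage_comp, hinv, ih]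
  have step1 : ∀ u, ν.real E * ν.real (cylinder u) ≤ κ * ν.real (cylinder u ∩ E) := by
    intro u
    have hm : Measurable (leftShift^[u.length] : Shift N → Shift N) :=
      measurable_leftShift.iterate _
    have i2 : IsFiniteMeasure (ENNReal.ofReal κ •
        (ν.restrict (cylinder u)).map (leftShift^[u.length])) :=
      Measure.smul_finite _ ENNReal.ofReal_ne_top
    have hle : ENNReal.ofReal (ν.real (cylinder u)) • ν
        ≤ ENNReal.ofReal κ • (ν.restrict (cylinder u)).map (leftShift^[u.length]) := by
      have i1 : IsFiniteMeasure (ENNReal.ofReal (ν.real (cylinder u)) • ν) :=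
        Measure.smul_finite _ ENNReal.ofReal_ne_top
      refine measure_le_of_cylinder_le fun v => ?_
      rw [measureReal_ennreal_smul_apply, measureReal_ennreal_smul_apply,
        ENNReal.toReal_ofReal measureReal_nonneg, ENNReal.toReal_ofReal hκ0,
        map_measureReal_apply hm (measurableSet_cylinder v),
        measureReal_restrict_apply (hm (measurableSet_cylinder v)), Set.inter_comm,
        ← cylinder_append]
      exact hν.mul_le h u v
    have := ENNReal.toReal_mono (measure_ne_top _ _) (hle E)
    change Measure.real _ E ≤ Measure.real _ E at this
    rw [measureReal_ennreal_smul_apply, measureReal_ennreal_smul_apply,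
      ENNReal.toReal_ofReal measureReal_nonneg, ENNReal.toReal_ofReal hκ0,
      map_measureReal_apply hm hE, hiter, measureReal_restrict_apply hE, Set.inter_comm] at this
    linarith
  have hle : ENNReal.ofReal (ν.real E) • ν ≤ ENNReal.ofReal κ • ν.restrict E := by
    have i1 : IsFiniteMeasure (ENNReal.ofReal (ν.real E) • ν) :=
      Measure.smul_finite _ ENNReal.ofReal_ne_top
    have i2 : IsFiniteMeasure (ENNReal.ofReal κ • ν.restrict E) :=
      Measure.smul_finite _ ENNReal.ofReal_ne_top
    refine measure_le_of_cylinder_le fun v => ?_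
    rw [measureReal_ennreal_smul_apply, measureReal_ennreal_smul_apply,
      ENNReal.toReal_ofReal measureReal_nonneg, ENNReal.toReal_ofReal hκ0,
      measureReal_restrict_apply (measurableSet_cylinder v)]
    exact step1 v
  -- Taking B to be the complement of E forces ν(E) ν(Eᶜ) = 0.
  have h0 := hle Eᶜ
  rw [Measure.smul_apply, Measure.smul_apply, Measure.restrict_apply hE.compl,
    Set.compl_inter_self, measure_empty, smul_zero, nonpos_iff_eq_zero, smul_eq_mul,
    mul_eq_zero, ENNReal.ofReal_eq_zero] at h0
  rw [eventuallyConst_set']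
  rcases h0 with h0 | h0
  · left
    rw [ae_eq_empty]
    exact (measureReal_eq_zero_iff).1 (le_antisymm h0 measureReal_nonneg)
  · right
    rwa [ae_eq_univ]

theorem log_le [NeZero N] (hν : IsGibbs θ C ν) (h : AlmostMul θ K) (w : List (Fin N)) :
    Real.log (wordSum w.length θ) + Real.log (ν.real (cylinder w))
      ≤ Real.log C + Real.log (θ w) := by
  have hC := hν.const_pos h
  have hZ := h.wordSum_pos w.length
  have hw := hν.real_pos h w
  have := Real.log_le_log (mul_pos hZ hw) (hν.le w)
  rwa [Real.log_mul hZ.ne' hw.ne', Real.log_mul hC.ne' (h.pos w).ne'] at this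

theorem le_log [NeZero N] (hν : IsGibbs θ C ν) (h : AlmostMul θ K) (w : List (Fin N)) :
    Real.log (θ w) ≤ Real.log C + (Real.log (wordSum w.length θ)
      + Real.log (ν.real (cylinder w))) := by
  have hC := hν.const_pos h
  have hZ := h.wordSum_pos w.length
  have hw := hν.real_pos h w
  have := Real.log_le_log (h.pos w) (hν.ge w)
  rwa [Real.log_mul hC.ne' (mul_pos hZ hw).ne', Real.log_mul hZ.ne' hw.ne'] at this

theorem isEquilibriumState [NeZero N] (hν : IsGibbs θ C ν) (h : AlmostMul θ K) :
    IsEquilibriumState θ ν := by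
  have hprob := hν.inv.1
  refine ⟨hν.inv, le_antisymm ?_ (h.entropy_add_Lam_le hν.inv)⟩
  have t0 : Tendsto (fun n : ℕ => 1 / (n : ℝ) * Real.log C) atTop (𝓝 0) := by
    simpa using tendsto_one_div_atTop_nhds_zero_nat.mul_const (Real.log C)
  have := h.tendsto_pressure.sub t0
  rw [sub_zero] at this
  refine le_of_tendsto_of_tendsto' this
    ((tendsto_entropy hν.inv).add (h.tendsto_wordSum_log hν.inv)) fun n => ?_
  rw [← mul_add, ← mul_sub]
  refine mul_le_mul_of_nonneg_left ?_ (by positivity)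
  have key : wordSum n (fun w => ν.real (cylinder w) *
        (Real.log (wordSum n θ) + Real.log (ν.real (cylinder w))))
      ≤ wordSum n (fun w => ν.real (cylinder w) * (Real.log C + Real.log (θ w))) :=
    wordSum_le_wordSum fun w hw =>
      mul_le_mul_of_nonneg_left (hw ▸ hν.log_le h w) measureReal_nonneg
  simp only [mul_add, wordSum_add_fun, wordSum_mul_right, wordSum_cylinder] at key
  unfold blockEntropy
  linarith

/-- By the Gibbs bound, log ν[w] is at least log θ(w) minus the log of the word sum minus log C.
Averaging against η leaves n (P - h(η) - Λ(θ, η)) plus bounded errors, and the linear term vanishes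
because η is an equilibrium state. -/
theorem relEntropy_le [NeZero N] (hν : IsGibbs θ C ν) (h : AlmostMul θ K)
    (hη : IsEquilibriumState θ η) (n : ℕ) :
    wordSum n (fun w => η.real (cylinder w) *
      (Real.log (η.real (cylinder w)) - Real.log (ν.real (cylinder w))))
      ≤ Real.log C + 2 * K := by
  have := hη.1.1
  have key : wordSum n (fun w => η.real (cylinder w) * Real.log (θ w))
      ≤ wordSum n (fun w => η.real (cylinder w) * (Real.log C + (Real.log (wordSum n θ)
        + Real.log (ν.real (cylinder w))))) :=
    wordSum_le_wordSum fun w hw =>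
      mul_le_mul_of_nonneg_left (hw ▸ hν.le_log h w) measureReal_nonneg
  simp only [mul_add, mul_sub, wordSum_add_fun, wordSum_sub_fun, wordSum_mul_right,
    wordSum_cylinder] at key ⊢
  have h1 := mul_entropy_le hη.1 n
  have h2 := (abs_le.1 (h.abs_log_wordSum_sub_le n)).2
  have h3 := (abs_le.1 (h.abs_wordSum_log_sub_le hη.1 n)).1
  have h4 := hη.2
  unfold blockEntropy at h1
  rw [h4] at h2
  linarith

open Classical in
-- Bounded relative entropy prevents η from charging a set that is exponentially small for ν; this
-- makes absolute continuity quantitative.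
theorem innerCyl_mul_le [NeZero N] (hν : IsGibbs θ C ν) (h : AlmostMul θ K)
    (hη : IsEquilibriumState θ η) {U : Set (Shift N)} {L : ℝ}
    (hU : ν.real U ≤ Real.exp (-L)) (n : ℕ) :
    η.real (innerCyl U n) * L ≤ Real.log C + 2 * K + 1 := by
  have := hη.1.1
  have := hν.inv.1
  have hpos := hν.real_pos h
  -- The test weights are those of ν, enlarged by exp L inside U. Their total stays at most 2
  -- because ν(U) ≤ exp (-L), while the comparison with η gains L on the cylinders inside U.
  let q : List (Fin N) → ℝ := fun w =>
    if cylinder w ⊆ U then ν.real (cylinder w) * Real.exp L else ν.real (cylinder w)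
  have hq : ∀ w, 0 < q w := by
    intro w
    have := hpos w
    dsimp only [q]
    split_ifs <;> positivity
  have key : wordSum n (fun w => η.real (cylinder w) *
      (Real.log (q w) - Real.log (η.real (cylinder w))))
      ≤ wordSum n (fun w => q w - η.real (cylinder w)) :=
    wordSum_le_wordSum fun w _ => mul_log_sub_log_le measureReal_nonneg (hq w).le
      fun e => absurd e (hq w).ne'
  have e1 : wordSum n (fun w => η.real (cylinder w) *
      (Real.log (q w) - Real.log (η.real (cylinder w))))
      = η.real (innerCyl U n) * L - wordSum n (fun w => η.real (cylinder w) *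
      (Real.log (η.real (cylinder w)) - Real.log (ν.real (cylinder w)))) := by
    rw [measureReal_innerCyl, ← wordSum_mul_right, ← wordSum_sub_fun]
    refine wordSum_congr fun w _ => ?_
    dsimp only [q]
    split_ifs
    · rw [Real.log_mul (hpos w).ne' (Real.exp_ne_zero _), Real.log_exp]
      ring
    · ring
  have e2 : wordSum n q ≤ 2 := by
    calc wordSum n q ≤ wordSum n (fun w =>
          (if cylinder w ⊆ U then ν.real (cylinder w) else 0) * Real.exp L
            + ν.real (cylinder w)) := by
          refine wordSum_le_wordSum fun w _ => ?_
          have := hpos w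
          dsimp only [q]
          split_ifs <;> linarith
      _ = ν.real (innerCyl U n) * Real.exp L + 1 := by
          rw [wordSum_add_fun, wordSum_mul_right, ← measureReal_innerCyl, wordSum_cylinder]
      _ ≤ Real.exp (-L) * Real.exp L + 1 := by
          gcongr
          exact (measureReal_mono (innerCyl_subset U n)).trans hU
      _ = 2 := by rw [← Real.exp_add]; norm_num
  rw [wordSum_sub_fun, wordSum_cylinder, e1] at key
  have := hν.relEntropy_le h hη n
  linarith

/-- If ν(B) = 0 < η(B), cover B by an open U with ν(U) ≤ exp (-L). Then η(B) L is bounded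
independently of L, which is absurd for large L. -/
theorem absolutelyContinuous [NeZero N] (hν : IsGibbs θ C ν) (h : AlmostMul θ K)
    (hη : IsEquilibriumState θ η) : η ≪ ν := by
  have := hη.1.1
  have := hν.inv.1
  intro B hB
  by_contra hB'
  have hpos : 0 < η.real B := by
    rw [measureReal_def]
    exact ENNReal.toReal_pos hB' (measure_ne_top _ _)
  obtain ⟨L, hL⟩ := exists_nat_gt ((Real.log C + 2 * K + 1) / η.real B)
  rw [div_lt_iff₀' hpos] at hL
  obtain ⟨U, hBU, hUo, hU⟩ := B.exists_isOpen_le_add ν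
    (ε := ENNReal.ofReal (Real.exp (-(L : ℝ)))) (by simp [Real.exp_pos])
  rw [hB, zero_add] at hU
  have hU' : ν.real U ≤ Real.exp (-(L : ℝ)) :=
    ENNReal.toReal_le_of_le_ofReal (Real.exp_pos _).le hU
  have t : Tendsto (fun n => η.real (innerCyl U n) * (L : ℝ)) atTop (𝓝 (η.real U * L)) :=
    ((ENNReal.tendsto_toReal (measure_ne_top _ _)).comp
      (tendsto_measure_innerCyl η hUo)).mul_const _
  have h1 : η.real U * L ≤ Real.log C + 2 * K + 1 :=
    le_of_tendsto' t fun n => hν.innerCyl_mul_le h hη hU' n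
  have h2 : η.real B ≤ η.real U := measureReal_mono hBU
  have := mul_le_mul_of_nonneg_right h2 (Nat.cast_nonneg (α := ℝ) L)
  linarith

/-- An invariant probability measure that is absolutely continuous with respect to an ergodic one
coincides with it. -/
theorem eq_of_isEquilibriumState [NeZero N] (hν : IsGibbs θ C ν) (h : AlmostMul θ K)
    (hη : IsEquilibriumState θ η) : η = ν := by
  have := hη.1.1
  have := hν.inv.1
  exact (hν.ergodic h).eq_of_absolutelyContinuous hη.1.2 (hν.absolutelyContinuous h hη)

end IsGibbs

end Gibbs

/-! ### The two-parameter family and the derivative of its zero curve -/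

section Family

variable {N : ℕ}

theorem AlmostMul.pressure_le [NeZero N] {θ θ' : List (Fin N) → ℝ} {K K' : ℝ}
    (h : AlmostMul θ K) (h' : AlmostMul θ' K') {a : ℝ}
    (hle : ∀ w, Real.log (θ' w) ≤ Real.log (θ w) + w.length * a) :
    pressure θ' ≤ pressure θ + a := by
  refine le_of_tendsto_of_tendsto h'.tendsto_pressure (h.tendsto_pressure.add_const a) ?_
  filter_upwards [eventually_gt_atTop 0] with n hn
  have hn' : (0 : ℝ) < n := by exact_mod_cast hn
  have h1 : wordSum n θ' ≤ wordSum n θ * Real.exp (n * a) := by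
    rw [← wordSum_mul_right]
    refine wordSum_le_wordSum fun w hw => ?_
    have hw' := h.pos w
    rw [← Real.log_le_log_iff (h'.pos w) (by positivity), Real.log_mul hw'.ne' (by positivity),
      Real.log_exp, ← hw]
    exact hle w
  have h2 := Real.log_le_log (h'.wordSum_pos n) h1
  rw [Real.log_mul (h.wordSum_pos n).ne' (by positivity), Real.log_exp] at h2
  calc _ ≤ 1 / (n : ℝ) * (Real.log (wordSum n θ) + n * a) :=
        mul_le_mul_of_nonneg_left h2 (by positivity)
    _ = _ := by field_simp

theorem AlmostMul.abs_Lam_le {θ : List (Fin N) → ℝ} {K : ℝ} (h : AlmostMul θ K)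
    {ν : Measure (Shift N)} (hν : IsInvariantProb ν) :
    |Lam θ ν| ≤ wordSum 1 (fun w => |Real.log (θ w)|) + K := by
  have := hν.1
  have h1 := h.abs_wordSum_log_sub_le hν 1
  have h2 : |wordSum 1 (fun w => ν.real (cylinder w) * Real.log (θ w))|
      ≤ wordSum 1 (fun w => |Real.log (θ w)|) := by
    refine (Finset.abs_sum_le_sum_abs _ _).trans (Finset.sum_le_sum fun w _ => ?_)
    rw [abs_mul, abs_of_nonneg measureReal_nonneg]
    exact mul_le_of_le_one_left (abs_nonneg _) measureReal_le_one
  simp only [Nat.cast_one, one_mul] at h1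
  rw [abs_le] at *
  constructor <;> linarith

/-- Up to an error K / n that does not depend on the measure, Λ is a finite sum of cylinder weights,
so it is continuous as a uniform limit. -/
theorem tendsto_Lam_of_tendsto_cylinder {ι : Type*} {F : Filter ι} {θ : List (Fin N) → ℝ} {K : ℝ}
    (h : AlmostMul θ K) {M : ι → Measure (Shift N)} {ν : Measure (Shift N)}
    (hM : ∀ i, IsInvariantProb (M i)) (hν : IsInvariantProb ν)
    (hlim : ∀ w, Tendsto (fun i => (M i).real (cylinder w)) F (𝓝 (ν.real (cylinder w)))) :
    Tendsto (fun i => Lam θ (M i)) F (𝓝 (Lam θ ν)) := by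
  rw [Metric.tendsto_nhds]
  intro ε hε
  obtain ⟨n, hn⟩ := exists_nat_gt ((2 * K + 1) / ε)
  have hK := h.nonneg
  have hn0 : (0 : ℝ) < n := lt_of_le_of_lt (by positivity) hn
  rw [div_lt_iff₀ hε] at hn
  have t : Tendsto (fun i => wordSum n (fun w => (M i).real (cylinder w) * Real.log (θ w))) F
      (𝓝 (wordSum n (fun w => ν.real (cylinder w) * Real.log (θ w)))) :=
    tendsto_finsetSum _ fun f _ => (hlim _).mul_const _
  filter_upwards [Metric.tendsto_nhds.1 t 1 one_pos] with i hi
  rw [Real.dist_eq] at hi ⊢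
  have h1 := abs_le.1 (h.abs_wordSum_log_sub_le (hM i) n)
  have h2 := abs_le.1 (h.abs_wordSum_log_sub_le hν n)
  have h3 := abs_lt.1 hi
  have h4 : n * |Lam θ (M i) - Lam θ ν| < n * ε := by
    rw [← abs_of_pos hn0, ← abs_mul, abs_of_pos hn0, abs_lt]
    constructor <;> nlinarith
  exact lt_of_mul_lt_mul_left h4 hn0.le

/-- The two-parameter family of potentials `a ^ q * b ^ (1 - q) * c ^ (-t)` at `x = (q, t)`. -/
noncomputable def family (a b c : List (Fin N) → ℝ) (x : ℝ × ℝ) (w : List (Fin N)) : ℝ :=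
  a w ^ x.1 * b w ^ (1 - x.1) * c w ^ (-x.2)

variable {a b c : List (Fin N) → ℝ} {Ka Kb Kc : ℝ}

theorem almostMul_family (ha : AlmostMul a Ka) (hb : AlmostMul b Kb) (hc : AlmostMul c Kc)
    (x : ℝ × ℝ) :
    AlmostMul (family a b c x) (|x.1| * Ka + |1 - x.1| * Kb + |-x.2| * Kc) :=
  ((ha.rpow x.1).mul (hb.rpow (1 - x.1))).mul (hc.rpow (-x.2))

theorem continuous_family (ha : AlmostMul a Ka) (hb : AlmostMul b Kb) (hc : AlmostMul c Kc)
    (w : List (Fin N)) : Continuous fun x => family a b c x w := by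
  unfold family
  refine (Continuous.mul ?_ ?_).mul ?_
  · exact continuous_const.rpow continuous_fst fun _ => Or.inl (ha.pos w).ne'
  · exact continuous_const.rpow (continuous_const.sub continuous_fst)
      fun _ => Or.inl (hb.pos w).ne'
  · exact continuous_const.rpow continuous_snd.neg fun _ => Or.inl (hc.pos w).ne'

theorem Lam_family (ha : AlmostMul a Ka) (hb : AlmostMul b Kb) (hc : AlmostMul c Kc)
    (x : ℝ × ℝ) {ν : Measure (Shift N)} (hν : IsInvariantProb ν) :
    Lam (family a b c x) ν = x.1 * Lam a ν + (1 - x.1) * Lam b ν - x.2 * Lam c ν := by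
  have h1 := ((ha.rpow x.1).mul (hb.rpow (1 - x.1))).Lam_mul (hc.rpow (-x.2)) hν
  have h2 := (ha.rpow x.1).Lam_mul (hb.rpow (1 - x.1)) hν
  rw [h2, ha.Lam_rpow _ hν, hb.Lam_rpow _ hν, hc.Lam_rpow _ hν] at h1
  change Lam (family a b c x) ν = _ at h1
  rw [h1]
  ring

variable [NeZero N]

/-- The sum h(ν) + Λ(·, ν) is affine in the parameters, bounds the pressure from below and equals it
at x. So ν gives a subgradient of the pressure. -/
theorem le_pressure_family (ha : AlmostMul a Ka) (hb : AlmostMul b Kb) (hc : AlmostMul c Kc)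
    {x : ℝ × ℝ} {ν : Measure (Shift N)} (hν : IsEquilibriumState (family a b c x) ν)
    (y : ℝ × ℝ) :
    pressure (family a b c x) + (y.1 - x.1) * (Lam a ν - Lam b ν) - (y.2 - x.2) * Lam c ν
      ≤ pressure (family a b c y) := by
  have h1 := (almostMul_family ha hb hc y).entropy_add_Lam_le hν.1
  have h2 := hν.2
  rw [Lam_family ha hb hc _ hν.1] at h1 h2
  rw [h2]
  linarith

/-- The subgradients are bounded uniformly over all invariant measures, so the pressure is
Lipschitz. -/
theorem continuous_pressure_family (ha : AlmostMul a Ka) (hb : AlmostMul b Kb)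
    (hc : AlmostMul c Kc) : Continuous fun x => pressure (family a b c x) := by
  obtain ⟨B, hB⟩ : ∃ B : ℝ, ∀ ν : Measure (Shift N), IsInvariantProb ν →
      |Lam a ν - Lam b ν| ≤ B ∧ |Lam c ν| ≤ B := by
    refine ⟨max (_ + _) _, fun ν hν => ⟨((abs_sub _ _).trans (add_le_add (ha.abs_Lam_le hν)
      (hb.abs_Lam_le hν))).trans (le_max_left _ _), (hc.abs_Lam_le hν).trans (le_max_right _ _)⟩⟩
  have key : ∀ x y : ℝ × ℝ, pressure (family a b c x) - pressure (family a b c y)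
      ≤ B * (|y.1 - x.1| + |y.2 - x.2|) := by
    intro x y
    obtain ⟨ν, hν⟩ := (almostMul_family ha hb hc x).exists_isGibbs
    have h := le_pressure_family ha hb hc
      (hν.isEquilibriumState (almostMul_family ha hb hc x)) y
    obtain ⟨h1, h2⟩ := hB ν hν.inv
    have h3 : -((y.1 - x.1) * (Lam a ν - Lam b ν)) ≤ |y.1 - x.1| * B := by
      refine (neg_le_abs _).trans ?_
      rw [abs_mul]
      exact mul_le_mul_of_nonneg_left h1 (abs_nonneg _)
    have h4 : (y.2 - x.2) * Lam c ν ≤ |y.2 - x.2| * B := by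
      refine (le_abs_self _).trans ?_
      rw [abs_mul]
      exact mul_le_mul_of_nonneg_left h2 (abs_nonneg _)
    linarith
  rw [continuous_iff_continuousAt]
  intro x
  rw [ContinuousAt, tendsto_iff_dist_tendsto_zero]
  have t : Tendsto (fun y : ℝ × ℝ => B * (|y.1 - x.1| + |y.2 - x.2|)) (𝓝 x) (𝓝 0) := by
    have : Continuous fun y : ℝ × ℝ => B * (|y.1 - x.1| + |y.2 - x.2|) := by fun_prop
    simpa using this.tendsto x
  refine squeeze_zero (fun _ => dist_nonneg) (fun y => ?_) t
  rw [Real.dist_eq, abs_le]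
  have h1 := key x y
  have h2 := key y x
  rw [abs_sub_comm x.1, abs_sub_comm x.2] at h2
  constructor <;> linarith

/-- Weights, word sums and Gibbs constants are continuous in the parameters, so every limit point of
the states ν y as y → x is a Gibbs state at x. By uniqueness it is ν x. -/
theorem tendsto_cylinder_family (ha : AlmostMul a Ka) (hb : AlmostMul b Kb)
    (hc : AlmostMul c Kc) {ν : ℝ × ℝ → Measure (Shift N)}
    (hν : ∀ x, IsGibbs (family a b c x)
      (Real.exp (4 * (|x.1| * Ka + |1 - x.1| * Kb + |-x.2| * Kc))) (ν x))
    (x : ℝ × ℝ) (w : List (Fin N)) :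
    Tendsto (fun y => (ν y).real (cylinder w)) (𝓝 x) (𝓝 ((ν x).real (cylinder w))) := by
  rw [tendsto_iff_ultrafilter]
  intro U hU
  obtain ⟨ν', hν', hlim⟩ := exists_tendsto_ultrafilter U ν fun y => (hν y).inv.1
  have hinv : IsInvariantProb ν' := by
    refine ⟨hν', measurable_leftShift, ?_⟩
    have : IsProbabilityMeasure (ν'.map leftShift) :=
      Measure.isProbabilityMeasure_map measurable_leftShift.aemeasurable
    refine measure_eq_of_cylinder_eq fun w => ?_
    rw [map_measureReal_apply measurable_leftShift (measurableSet_cylinder w)]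
    refine tendsto_nhds_unique
      (hlim _ ((isClopen_cylinder w).preimage continuous_leftShift))
      ((hlim _ (isClopen_cylinder w)).congr fun y => ?_)
    exact ((hν y).inv.2.measureReal_preimage (measurableSet_cylinder w).nullMeasurableSet).symm
  have hC : Continuous fun x : ℝ × ℝ =>
      Real.exp (4 * (|x.1| * Ka + |1 - x.1| * Kb + |-x.2| * Kc)) := by fun_prop
  have hθ := continuous_family ha hb hc
  have hZ : ∀ n, Continuous fun x => wordSum n (family a b c x) := fun n =>
    continuous_finsetSum _ fun f _ => hθ _
  have hG : IsGibbs (family a b c x)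
      (Real.exp (4 * (|x.1| * Ka + |1 - x.1| * Kb + |-x.2| * Kc))) ν' := by
    refine ⟨hinv, fun v => ?_, fun v => ?_⟩
    · exact le_of_tendsto_of_tendsto'
        ((((hZ v.length).tendsto x).mono_left hU).mul (hlim _ (isClopen_cylinder v)))
        (((hC.tendsto x).mono_left hU).mul (((hθ v).tendsto x).mono_left hU))
        fun y => (hν y).le v
    · exact le_of_tendsto_of_tendsto' (((hθ v).tendsto x).mono_left hU)
        (((hC.tendsto x).mono_left hU).mul
          ((((hZ v.length).tendsto x).mono_left hU).mul (hlim _ (isClopen_cylinder v))))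
        fun y => (hν y).ge v
  have hA := almostMul_family ha hb hc x
  rw [← (hν x).eq_of_isEquilibriumState hA (hG.isEquilibriumState hA)]
  exact hlim _ (isClopen_cylinder w)

/-- Along a continuous curve on which the pressure vanishes, the second parameter is
differentiable, with slope given by the equilibrium state. -/
theorem hasDerivAt_of_pressure_family_eq_zero (ha : AlmostMul a Ka) (hb : AlmostMul b Kb)
    (hc : AlmostMul c Kc) (hneg : ∀ ν, IsInvariantProb ν → Lam c ν < 0) {τ : ℝ → ℝ} {q : ℝ}
    (hτ : ContinuousAt τ q) (hzero : ∀ᶠ q' in 𝓝 q, pressure (family a b c (q', τ q')) = 0)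
    {ν : Measure (Shift N)} (hν : IsEquilibriumState (family a b c (q, τ q)) ν) :
    HasDerivAt τ ((Lam a ν - Lam b ν) / Lam c ν) q := by
  have hA := almostMul_family ha hb hc
  choose M hM using fun x => (hA x).exists_isGibbs
  have hE : ∀ x, IsEquilibriumState (family a b c x) (M x) := fun x =>
    (hM x).isEquilibriumState (hA x)
  rw [(hM (q, τ q)).eq_of_isEquilibriumState (hA _) hν]
  set G : ℝ × ℝ → ℝ := fun x => (Lam a (M x) - Lam b (M x)) / Lam c (M x) with hG
  have hlim : ∀ {θ : List (Fin N) → ℝ} {K : ℝ}, AlmostMul θ K → ∀ x,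
      Tendsto (fun y => Lam θ (M y)) (𝓝 x) (𝓝 (Lam θ (M x))) := fun hθ x =>
    tendsto_Lam_of_tendsto_cylinder hθ (fun y => (hM y).inv) (hM x).inv
      (tendsto_cylinder_family ha hb hc hM x)
  have hGc : ContinuousAt (fun q' => G (q', τ q')) q := by
    have h1 : ContinuousAt (fun q' => (q', τ q')) q := continuousAt_id.prodMk hτ
    have h2 : ContinuousAt G (q, τ q) :=
      ((hlim ha _).sub (hlim hb _)).div (hlim hc _) (hneg _ (hM _).inv).ne
    exact ContinuousAt.comp (f := fun q' => (q', τ q')) h2 h1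
  rw [hasDerivAt_iff_isLittleO, Asymptotics.isLittleO_iff]
  intro ε hε
  have hq := hzero.self_of_nhds
  filter_upwards [hzero, Metric.tendsto_nhds.1 hGc ε hε] with q' h0 hd
  rw [Real.dist_eq] at hd
  -- Both pressures vanish. The minorant at q bounds τ q' - τ q above, the one at q' bounds it
  -- below; dividing by the negative Λ(c) reverses the inequalities.
  have h1 := le_pressure_family ha hb hc (hE (q, τ q)) (q', τ q')
  have h2 := le_pressure_family ha hb hc (hE (q', τ q')) (q, τ q)
  rw [h0, hq] at h1 h2
  have n1 := hneg _ (hM (q, τ q)).inv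
  have n2 := hneg _ (hM (q', τ q')).inv
  have e1 : Lam a (M (q, τ q)) - Lam b (M (q, τ q)) = G (q, τ q) * Lam c (M (q, τ q)) := by
    rw [hG]; field_simp [n1.ne]
  have e2 : Lam a (M (q', τ q')) - Lam b (M (q', τ q'))
      = G (q', τ q') * Lam c (M (q', τ q')) := by
    rw [hG]; field_simp [n2.ne]
  rw [e1] at h1
  rw [e2] at h2
  simp only at h1 h2
  have h1' : τ q' - τ q ≤ (q' - q) * G (q, τ q) := by
    by_contra! hlt
    nlinarith
  have h2' : (q' - q) * G (q', τ q') ≤ τ q' - τ q := by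
    by_contra! hlt
    nlinarith
  rw [Real.norm_eq_abs, Real.norm_eq_abs, smul_eq_mul]
  calc |τ q' - τ q - (q' - q) * G (q, τ q)|
      ≤ |(q' - q) * (G (q', τ q') - G (q, τ q))| := by
        rw [abs_of_nonpos (by linarith)]
        refine le_trans ?_ (neg_le_abs _)
        linarith
    _ ≤ ε * |q' - q| := by
        rw [abs_mul, mul_comm]
        exact mul_le_mul_of_nonneg_right hd.le (abs_nonneg _)

end Family

/-! ### Areas and projections in the plane -/

section PlaneGeometry

/-- The signed area spanned by two vectors of the plane. -/
def cross (x y : EuclideanSpace ℝ (Fin 2)) : ℝ := x 0 * y 1 - x 1 * y 0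

/-- The dot product of two vectors of the plane. -/
def dot (x y : EuclideanSpace ℝ (Fin 2)) : ℝ := x 0 * y 0 + x 1 * y 1

/-- Rotation by a right angle. -/
noncomputable def rot (x : EuclideanSpace ℝ (Fin 2)) : EuclideanSpace ℝ (Fin 2) := !₂[-x 1, x 0]

theorem normsq_eq (x : EuclideanSpace ℝ (Fin 2)) : ‖x‖ ^ 2 = x 0 ^ 2 + x 1 ^ 2 := by
  rw [EuclideanSpace.real_norm_sq_eq, Fin.sum_univ_two]

theorem norm_rot (x : EuclideanSpace ℝ (Fin 2)) : ‖rot x‖ = ‖x‖ := by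
  rw [← sq_eq_sq₀ (norm_nonneg _) (norm_nonneg _), normsq_eq, normsq_eq]
  simp [rot]
  ring

theorem cross_rot (x : EuclideanSpace ℝ (Fin 2)) : cross x (rot x) = ‖x‖ ^ 2 := by
  rw [normsq_eq]
  simp [cross, rot]
  ring

theorem dot_sq_add_cross_sq (x y : EuclideanSpace ℝ (Fin 2)) :
    dot x y ^ 2 + cross x y ^ 2 = ‖x‖ ^ 2 * ‖y‖ ^ 2 := by
  rw [normsq_eq, normsq_eq, dot, cross]
  ring

theorem abs_dot_le (x y : EuclideanSpace ℝ (Fin 2)) : |dot x y| ≤ ‖x‖ * ‖y‖ := by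
  apply abs_le_of_sq_le_sq _ (by positivity)
  rw [mul_pow, ← dot_sq_add_cross_sq]
  exact le_add_of_nonneg_right (sq_nonneg _)

theorem abs_cross_le (x y : EuclideanSpace ℝ (Fin 2)) : |cross x y| ≤ ‖x‖ * ‖y‖ := by
  apply abs_le_of_sq_le_sq _ (by positivity)
  rw [mul_pow, ← dot_sq_add_cross_sq]
  exact le_add_of_nonneg_left (sq_nonneg _)

theorem cross_sub_smul (x y : EuclideanSpace ℝ (Fin 2)) (c : ℝ) :
    cross (x - c • y) y = cross x y := by
  simp [cross]
  ring

theorem dot_sub_smul (x y z : EuclideanSpace ℝ (Fin 2)) (c : ℝ) :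
    dot (x - c • y) z = dot x z - c * dot y z := by
  simp [dot]
  ring

theorem dot_self (x : EuclideanSpace ℝ (Fin 2)) : dot x x = ‖x‖ ^ 2 := by
  rw [normsq_eq, dot]
  ring

theorem normsq_smul_eq (e x : EuclideanSpace ℝ (Fin 2)) :
    ‖e‖ ^ 2 • x = dot x e • e + cross e x • rot e := by
  rw [normsq_eq]
  ext i
  fin_cases i <;> simp [dot, cross, rot] <;> ring

/-- The coefficient of the orthogonal projection of `z` to the line of `p`. -/
noncomputable def projCoeff (z p : EuclideanSpace ℝ (Fin 2)) : ℝ := dot z p / ‖p‖ ^ 2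

/-- Subtracting a multiple of p preserves the area with p, and the remainder is orthogonal to p, so
only the area term survives in `dot_sq_add_cross_sq`. -/
theorem norm_sub_projCoeff_mul {z p : EuclideanSpace ℝ (Fin 2)} (hp : p ≠ 0) :
    ‖z - projCoeff z p • p‖ * ‖p‖ = |cross z p| := by
  have hp' : ‖p‖ ^ 2 ≠ 0 := by simpa using hp
  have h := dot_sq_add_cross_sq (z - projCoeff z p • p) p
  rw [cross_sub_smul, dot_sub_smul, dot_self, projCoeff, div_mul_cancel₀ _ hp', sub_self,
    zero_pow two_ne_zero, zero_add, ← mul_pow] at h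
  rw [← abs_of_nonneg (by positivity : 0 ≤ ‖z - projCoeff z p • p‖ * ‖p‖)]
  exact ((sq_eq_sq_iff_abs_eq_abs _ _).1 h).symm

theorem projCoeff_add_smul (z p : EuclideanSpace ℝ (Fin 2)) (hp : p ≠ 0) (c : ℝ) :
    projCoeff (z - c • p) p = projCoeff z p - c := by
  have hp' : ‖p‖ ^ 2 ≠ 0 := by simpa using hp
  rw [projCoeff, dot_sub_smul, dot_self, projCoeff]
  field_simp

theorem abs_projCoeff_mul_le {z p : EuclideanSpace ℝ (Fin 2)} (hp : p ≠ 0) :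
    |projCoeff z p| * ‖p‖ ≤ ‖z‖ := by
  have hp' : 0 < ‖p‖ := norm_pos_iff.2 hp
  rw [projCoeff, abs_div, abs_of_nonneg (sq_nonneg ‖p‖), div_mul_eq_mul_div,
    div_le_iff₀ (by positivity), pow_two, ← mul_assoc]
  exact mul_le_mul_of_nonneg_right (abs_dot_le z p) hp'.le

end PlaneGeometry

/-! ### Matrix products acting on vectors -/

section WordAction

variable {N : ℕ} (A : Fin N → Matrix.GeneralLinearGroup (Fin 2) ℝ)

/-- The action of `A_w` on the plane. -/
noncomputable def act (w : List (Fin N)) (x : EuclideanSpace ℝ (Fin 2)) :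
    EuclideanSpace ℝ (Fin 2) :=
  Matrix.toEuclideanCLM (n := Fin 2) (𝕜 := ℝ) (wordProd A w : Matrix (Fin 2) (Fin 2) ℝ) x

/-- The absolute value of the determinant of `A_w`. -/
noncomputable def absDet (w : List (Fin N)) : ℝ :=
  |(wordProd A w : Matrix (Fin 2) (Fin 2) ℝ).det|

theorem toEuclideanCLM_apply_two (M : Matrix (Fin 2) (Fin 2) ℝ) (x : EuclideanSpace ℝ (Fin 2))
    (i : Fin 2) :
    Matrix.toEuclideanCLM (n := Fin 2) (𝕜 := ℝ) M x i = M i 0 * x 0 + M i 1 * x 1 := by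
  simp [Matrix.mulVec, dotProduct, Fin.sum_univ_two]

theorem cross_toEuclideanCLM (M : Matrix (Fin 2) (Fin 2) ℝ) (x y : EuclideanSpace ℝ (Fin 2)) :
    cross (Matrix.toEuclideanCLM (n := Fin 2) (𝕜 := ℝ) M x)
      (Matrix.toEuclideanCLM (n := Fin 2) (𝕜 := ℝ) M y) = M.det * cross x y := by
  rw [cross, toEuclideanCLM_apply_two, toEuclideanCLM_apply_two, toEuclideanCLM_apply_two,
    toEuclideanCLM_apply_two, Matrix.det_fin_two, cross]
  ring

theorem norm_toEuclideanCLM_le (M : Matrix (Fin 2) (Fin 2) ℝ) (x : EuclideanSpace ℝ (Fin 2)) :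
    ‖Matrix.toEuclideanCLM (n := Fin 2) (𝕜 := ℝ) M x‖ ≤ opNorm M * ‖x‖ :=
  ContinuousLinearMap.le_opNorm _ _

theorem opNorm_nonneg (M : Matrix (Fin 2) (Fin 2) ℝ) : 0 ≤ opNorm M := norm_nonneg _

theorem opNorm_mul_le (M M' : Matrix (Fin 2) (Fin 2) ℝ) :
    opNorm (M * M') ≤ opNorm M * opNorm M' := by
  unfold opNorm
  rw [map_mul]
  exact norm_mul_le _ _

/-- Put x = g⁻¹ y. The square on x and `rot x` has an image of area |det g| ‖x‖², which is at most
‖y‖ · ‖g‖ ‖x‖. -/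
theorem absDet_mul_opNorm_inv_le (g : Matrix.GeneralLinearGroup (Fin 2) ℝ) :
    |(g : Matrix (Fin 2) (Fin 2) ℝ).det| *
      opNorm ((g⁻¹ : Matrix.GeneralLinearGroup (Fin 2) ℝ) : Matrix (Fin 2) (Fin 2) ℝ)
      ≤ opNorm (g : Matrix (Fin 2) (Fin 2) ℝ) := by
  have hd : 0 < |(g : Matrix (Fin 2) (Fin 2) ℝ).det| := abs_pos.2 g.det_ne_zero
  rw [← le_div_iff₀' hd]
  refine ContinuousLinearMap.opNorm_le_bound _ (div_nonneg (opNorm_nonneg _) hd.le) fun y => ?_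
  set x := Matrix.toEuclideanCLM (n := Fin 2) (𝕜 := ℝ)
    ((g⁻¹ : Matrix.GeneralLinearGroup (Fin 2) ℝ) : Matrix (Fin 2) (Fin 2) ℝ) y with hx
  have hy : Matrix.toEuclideanCLM (n := Fin 2) (𝕜 := ℝ) (g : Matrix (Fin 2) (Fin 2) ℝ) x = y := by
    rw [hx, ← mul_apply_eq_comp, ← map_mul, ← Units.val_mul, mul_inv_cancel,
      Units.val_one, map_one, one_apply_eq_self]
  rcases (norm_nonneg x).eq_or_lt with h0 | h0
  · rw [← h0]
    exact mul_nonneg (div_nonneg (opNorm_nonneg _) hd.le) (norm_nonneg _)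
  · have h1 := cross_toEuclideanCLM (g : Matrix (Fin 2) (Fin 2) ℝ) x (rot x)
    rw [hy, cross_rot] at h1
    have h2 := (abs_cross_le y _).trans (mul_le_mul_of_nonneg_left
      (norm_toEuclideanCLM_le (g : Matrix (Fin 2) (Fin 2) ℝ) (rot x)) (norm_nonneg y))
    rw [h1, abs_mul, abs_of_nonneg (sq_nonneg ‖x‖), norm_rot] at h2
    rw [div_mul_eq_mul_div, le_div_iff₀ hd]
    refine le_of_mul_le_mul_right ?_ h0
    linarith

theorem absDet_mul_opNorm_inv (g : Matrix.GeneralLinearGroup (Fin 2) ℝ) :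
    |(g : Matrix (Fin 2) (Fin 2) ℝ).det| *
      opNorm ((g⁻¹ : Matrix.GeneralLinearGroup (Fin 2) ℝ) : Matrix (Fin 2) (Fin 2) ℝ)
      = opNorm (g : Matrix (Fin 2) (Fin 2) ℝ) := by
  refine le_antisymm (absDet_mul_opNorm_inv_le g) ?_
  have h := absDet_mul_opNorm_inv_le g⁻¹
  have hd : 0 < |(g : Matrix (Fin 2) (Fin 2) ℝ).det| := abs_pos.2 g.det_ne_zero
  have e : |(g : Matrix (Fin 2) (Fin 2) ℝ).det| *
      |((g⁻¹ : Matrix.GeneralLinearGroup (Fin 2) ℝ) : Matrix (Fin 2) (Fin 2) ℝ).det| = 1 := by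
    rw [← abs_mul, ← Matrix.det_mul, ← Units.val_mul, mul_inv_cancel, Units.val_one,
      Matrix.det_one, abs_one]
  rw [inv_inv] at h
  calc opNorm (g : Matrix (Fin 2) (Fin 2) ℝ)
      = |(g : Matrix (Fin 2) (Fin 2) ℝ).det| *
      (|((g⁻¹ : Matrix.GeneralLinearGroup (Fin 2) ℝ) : Matrix (Fin 2) (Fin 2) ℝ).det| *
        opNorm (g : Matrix (Fin 2) (Fin 2) ℝ)) := by rw [← mul_assoc, e, one_mul]
    _ ≤ _ := mul_le_mul_of_nonneg_left h hd.le

theorem opNorm_pos (g : Matrix.GeneralLinearGroup (Fin 2) ℝ) :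
    0 < opNorm (g : Matrix (Fin 2) (Fin 2) ℝ) := by
  refine (opNorm_nonneg _).lt_of_ne fun h => ?_
  have h0 : (g : Matrix (Fin 2) (Fin 2) ℝ) = 0 := by
    have : Matrix.toEuclideanCLM (n := Fin 2) (𝕜 := ℝ) (g : Matrix (Fin 2) (Fin 2) ℝ) = 0 :=
      norm_eq_zero.1 h.symm
    exact (map_eq_zero_iff _ (Matrix.toEuclideanCLM (n := Fin 2) (𝕜 := ℝ)).injective).1 this
  exact g.ne_zero h0

theorem absDet_pos (w : List (Fin N)) : 0 < absDet A w :=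
  abs_pos.2 (wordProd A w).det_ne_zero

theorem alpha₁_pos (w : List (Fin N)) : 0 < alpha₁ A w := opNorm_pos _

theorem alpha₂_pos (w : List (Fin N)) : 0 < alpha₂ A w := inv_pos.2 (opNorm_pos _)

theorem alpha₂_eq (w : List (Fin N)) : alpha₂ A w = absDet A w * (alpha₁ A w)⁻¹ := by
  have h := absDet_mul_opNorm_inv (wordProd A w)
  have h1 := opNorm_pos (wordProd A w)
  have h2 := opNorm_pos (wordProd A w)⁻¹
  rw [alpha₂, alpha₁, absDet, ← h]
  have := absDet_pos A w
  rw [absDet] at this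
  field_simp

theorem wordProd_append (v w : List (Fin N)) :
    wordProd A (v ++ w) = wordProd A v * wordProd A w := by
  simp [wordProd]

theorem act_append (v w : List (Fin N)) (x : EuclideanSpace ℝ (Fin 2)) :
    act A (v ++ w) x = act A v (act A w x) := by
  simp only [act, wordProd_append, Units.val_mul, map_mul, mul_apply_eq_comp]

theorem act_nil (x : EuclideanSpace ℝ (Fin 2)) : act A [] x = x := by
  simp [act, wordProd]

theorem absDet_append (v w : List (Fin N)) : absDet A (v ++ w) = absDet A v * absDet A w := by
  simp only [absDet, wordProd_append, Units.val_mul, Matrix.det_mul, abs_mul]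

theorem absDet_nil : absDet A [] = 1 := by simp [absDet, wordProd]

theorem norm_act_le (w : List (Fin N)) (x : EuclideanSpace ℝ (Fin 2)) :
    ‖act A w x‖ ≤ alpha₁ A w * ‖x‖ := norm_toEuclideanCLM_le _ x

theorem abs_cross_act (w : List (Fin N)) (x y : EuclideanSpace ℝ (Fin 2)) :
    |cross (act A w x) (act A w y)| = absDet A w * |cross x y| := by
  rw [act, act, cross_toEuclideanCLM, abs_mul, absDet]

theorem alpha₁_append_le (v w : List (Fin N)) :
    alpha₁ A (v ++ w) ≤ alpha₁ A v * alpha₁ A w := by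
  simp only [alpha₁, wordProd_append, Units.val_mul]
  exact opNorm_mul_le _ _

theorem act_sub_smul (w : List (Fin N)) (x y : EuclideanSpace ℝ (Fin 2)) (c : ℝ) :
    act A w (x - c • y) = act A w x - c • act A w y := by
  simp [act]

theorem absDet_mul_norm_le (w : List (Fin N)) (x : EuclideanSpace ℝ (Fin 2)) :
    absDet A w * ‖x‖ ≤ alpha₁ A w * ‖act A w x‖ := by
  rcases (norm_nonneg x).eq_or_lt with h0 | h0
  · rw [← h0, mul_zero]
    exact mul_nonneg (alpha₁_pos A w).le (norm_nonneg _)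
  · have h1 := abs_cross_act A w x (rot x)
    rw [cross_rot, abs_of_nonneg (sq_nonneg ‖x‖)] at h1
    have h2 := (abs_cross_le (act A w x) _).trans (mul_le_mul_of_nonneg_left
      (norm_act_le A w (rot x)) (norm_nonneg (act A w x)))
    rw [h1, norm_rot] at h2
    refine le_of_mul_le_mul_right ?_ h0
    linarith

theorem act_ne_zero (w : List (Fin N)) {x : EuclideanSpace ℝ (Fin 2)} (hx : x ≠ 0) :
    act A w x ≠ 0 := by
  intro h
  have := absDet_mul_norm_le A w x
  rw [h, norm_zero, mul_zero] at this
  exact absurd (mul_pos (absDet_pos A w) (norm_pos_iff.2 hx)) this.not_gt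

theorem alpha₁_mul_alpha₂_le (v w : List (Fin N)) :
    alpha₁ A v * alpha₂ A w ≤ alpha₁ A (v ++ w) := by
  have h : alpha₁ A v ≤ alpha₁ A (v ++ w) * (alpha₂ A w)⁻¹ := by
    rw [alpha₂, inv_inv, alpha₁, alpha₁]
    refine le_trans (le_of_eq ?_) (opNorm_mul_le _ _)
    rw [wordProd_append, ← Units.val_mul, mul_assoc, mul_inv_cancel, mul_one]
  have h2 := alpha₂_pos A w
  calc _ ≤ alpha₁ A (v ++ w) * (alpha₂ A w)⁻¹ * alpha₂ A w :=
        mul_le_mul_of_nonneg_right h h2.le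
    _ = _ := by field_simp

/-- The factor 2 makes it unnecessary to find a vector that attains the norm. -/
theorem exists_le_norm_act (w : List (Fin N)) :
    ∃ x : EuclideanSpace ℝ (Fin 2), x ≠ 0 ∧ alpha₁ A w * ‖x‖ ≤ 2 * ‖act A w x‖ := by
  by_contra! h
  have h1 := alpha₁_pos A w
  have : alpha₁ A w ≤ alpha₁ A w / 2 := by
    refine ContinuousLinearMap.opNorm_le_bound _ (by positivity) fun x => ?_
    change ‖act A w x‖ ≤ _
    rcases eq_or_ne x 0 with rfl | hx
    · simp [act]
    · linarith [h x hx]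
  linarith

/-- The squared stretch of `x` under `A_w`, relative to the determinant. -/
noncomputable def stretch (x : EuclideanSpace ℝ (Fin 2)) (w : List (Fin N)) : ℝ :=
  ‖act A w x‖ ^ 2 / absDet A w

theorem stretch_pos {x : EuclideanSpace ℝ (Fin 2)} (hx : x ≠ 0) (w : List (Fin N)) :
    0 < stretch A x w :=
  div_pos (pow_pos (norm_pos_iff.2 (act_ne_zero A w hx)) 2) (absDet_pos A w)

theorem stretch_nil (x : EuclideanSpace ℝ (Fin 2)) : stretch A x [] = ‖x‖ ^ 2 := by
  rw [stretch, act_nil, absDet_nil, div_one]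

theorem stretch_act (x : EuclideanSpace ℝ (Fin 2)) (v w : List (Fin N)) :
    stretch A (act A w x) v = stretch A x (v ++ w) * absDet A w := by
  have := absDet_pos A w
  rw [stretch, stretch, act_append, absDet_append]
  field_simp

/-- The sum of `f` over the proper suffixes of a list. -/
def suffixSum (f : List (Fin N) → ℝ) : List (Fin N) → ℝ
  | [] => 0
  | _ :: s => suffixSum f s + f s

theorem suffixSum_le {f : List (Fin N) → ℝ} {b : ℕ → ℝ} {w : List (Fin N)}
    (h : ∀ s, s <:+ w → s ≠ w → f s ≤ b s.length) :
    suffixSum f w ≤ ∑ k ∈ Finset.range w.length, b k := by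
  induction w with
  | nil => simp [suffixSum]
  | cons i s ih =>
    rw [suffixSum, List.length_cons, Finset.sum_range_succ]
    refine add_le_add (ih fun s' h1 _ => h s' (h1.trans (List.suffix_cons i s)) ?_)
      (h s (List.suffix_cons i s) (by simp))
    rintro rfl
    have := h1.length_le
    simp at this

/-! ### Shear estimates -/

section Distortion

variable {A} {κ : ℝ} (hκ : ∀ i, alpha₁ A [i] ^ 2 ≤ κ * absDet A [i])
include hκ

/-- In orthogonal frames along x and along A_w x the matrix A_w is triangular, and this coefficient
is its normalised off-diagonal entry. Prepending a letter i to s keeps the old coefficient and adds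
the one that A_i creates from the orthogonal remainder z. Since ‖z‖ ‖A_s x‖ = |det A_s| ‖x‖², the
increment is at most κ ‖x‖² / `stretch A x s`. -/
theorem abs_projCoeff_act_le {x : EuclideanSpace ℝ (Fin 2)} (hx : x ≠ 0) (w : List (Fin N)) :
    |projCoeff (act A w (rot x)) (act A w x)|
      ≤ κ * ‖x‖ ^ 2 * suffixSum (fun s => (stretch A x s)⁻¹) w := by
  induction w with
  | nil =>
    have : dot (rot x) x = 0 := by simp [dot, rot]; ring
    simp [act_nil, projCoeff, this, suffixSum]
  | cons i s ih =>
    set p := act A s x with hp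
    have hp0 : p ≠ 0 := act_ne_zero A s hx
    have hp0' : 0 < ‖p‖ := norm_pos_iff.2 hp0
    set c := projCoeff (act A s (rot x)) p with hc
    set z := act A s (rot x) - c • p with hz
    have hq0 : act A [i] p ≠ 0 := act_ne_zero A [i] hp0
    have hq0' : 0 < ‖act A [i] p‖ := norm_pos_iff.2 hq0
    have e1 : ∀ y, act A (i :: s) y = act A [i] (act A s y) := fun y => act_append A [i] s y
    have e2 : projCoeff (act A [i] z) (act A [i] p)
        = projCoeff (act A (i :: s) (rot x)) (act A (i :: s) x) - c := by
      rw [e1, e1, hz, act_sub_smul, projCoeff_add_smul _ _ hq0]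
    have hzn : ‖z‖ * ‖p‖ = absDet A s * ‖x‖ ^ 2 := by
      rw [hz, hc, norm_sub_projCoeff_mul hp0, hp, abs_cross_act, ← cross_rot x]
      congr 1
      rw [show cross (rot x) x = -cross x (rot x) by simp only [cross]; ring, abs_neg, cross_rot,
        abs_of_nonneg (sq_nonneg _)]
    have h1 : |projCoeff (act A [i] z) (act A [i] p)| * ‖act A [i] p‖ ≤ alpha₁ A [i] * ‖z‖ :=
      (abs_projCoeff_mul_le hq0).trans (norm_act_le A [i] z)
    have h2 := absDet_mul_norm_le A [i] p
    have hd := absDet_pos A [i]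
    have hds := absDet_pos A s
    have ha := alpha₁_pos A [i]
    have h3 : |projCoeff (act A [i] z) (act A [i] p)| ≤ κ * ‖x‖ ^ 2 * (stretch A x s)⁻¹ := by
      rw [stretch, inv_div, ← mul_div_assoc, le_div_iff₀ (pow_pos hp0' 2)]
      refine le_of_mul_le_mul_left ?_ hd
      set P := |projCoeff (act A [i] z) (act A [i] p)| with hP
      have hP0 : 0 ≤ P := abs_nonneg _
      calc absDet A [i] * (P * ‖p‖ ^ 2) = P * (absDet A [i] * ‖p‖) * ‖p‖ := by ring
        _ ≤ P * (alpha₁ A [i] * ‖act A [i] p‖) * ‖p‖ := by gcongr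
        _ = alpha₁ A [i] * (P * ‖act A [i] p‖) * ‖p‖ := by ring
        _ ≤ alpha₁ A [i] * (alpha₁ A [i] * ‖z‖) * ‖p‖ := by gcongr
        _ = alpha₁ A [i] ^ 2 * (‖z‖ * ‖p‖) := by ring
        _ ≤ (κ * absDet A [i]) * (absDet A s * ‖x‖ ^ 2) := by
            rw [hzn]
            exact mul_le_mul_of_nonneg_right (hκ i) (by positivity)
        _ = _ := by ring
    rw [suffixSum, mul_add]
    have e3 : projCoeff (act A (i :: s) (rot x)) (act A (i :: s) x)
        = c + projCoeff (act A [i] z) (act A [i] p) := by rw [e2]; ring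
    rw [e3]
    exact (abs_add_le _ _).trans (add_le_add ih h3)

/-- Expand a vector in x and `rot x`. The image of `rot x` has a component along A_w x, bounded by
the shear estimate, and an orthogonal remainder whose length is fixed by the determinant. So A_w is
not much larger than its stretch along x unless some suffix compresses x. -/
theorem alpha₁_mul_norm_le {x : EuclideanSpace ℝ (Fin 2)} (hx : x ≠ 0) (w : List (Fin N)) :
    alpha₁ A w * ‖x‖ ≤ ‖act A w x‖ *
      (1 + κ * ‖x‖ ^ 2 * suffixSum (fun s => (stretch A x s)⁻¹) w + ‖x‖ ^ 2 / stretch A x w) := by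
  have hx' : 0 < ‖x‖ := norm_pos_iff.2 hx
  set p := act A w x with hp
  have hp0 : p ≠ 0 := act_ne_zero A w hx
  have hp0' : 0 < ‖p‖ := norm_pos_iff.2 hp0
  have hc := abs_projCoeff_act_le hκ hx w
  set S := suffixSum (fun s => (stretch A x s)⁻¹) w
  rw [← hp] at hc
  set c := projCoeff (act A w (rot x)) p with hcdef
  have hzn : ‖act A w (rot x) - c • p‖ * ‖p‖ = absDet A w * ‖x‖ ^ 2 := by
    rw [hcdef, norm_sub_projCoeff_mul hp0, hp, abs_cross_act]
    congr 1
    rw [show cross (rot x) x = -cross x (rot x) by simp only [cross]; ring, abs_neg, cross_rot,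
      abs_of_nonneg (sq_nonneg _)]
  have hd := absDet_pos A w
  have hzn' : ‖act A w (rot x) - c • p‖ = ‖p‖ * (‖x‖ ^ 2 / stretch A x w) := by
    rw [stretch, ← hp]
    field_simp
    rw [hzn, mul_comm]
  have hrot : ‖act A w (rot x)‖ ≤ ‖p‖ * (κ * ‖x‖ ^ 2 * S + ‖x‖ ^ 2 / stretch A x w) := by
    calc ‖act A w (rot x)‖ = ‖c • p + (act A w (rot x) - c • p)‖ := by congr 1; abel
      _ ≤ |c| * ‖p‖ + ‖p‖ * (‖x‖ ^ 2 / stretch A x w) := by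
          rw [← hzn', ← Real.norm_eq_abs, ← norm_smul]
          exact norm_add_le _ _
      _ ≤ κ * ‖x‖ ^ 2 * S * ‖p‖ + ‖p‖ * (‖x‖ ^ 2 / stretch A x w) := by gcongr
      _ = _ := by ring
  have hR : 0 ≤ κ * ‖x‖ ^ 2 * S + ‖x‖ ^ 2 / stretch A x w :=
    nonneg_of_mul_nonneg_right ((norm_nonneg _).trans hrot) hp0'
  rw [← le_div_iff₀ hx']
  refine ContinuousLinearMap.opNorm_le_bound _
    (div_nonneg (mul_nonneg hp0'.le (by linarith)) hx'.le) fun y => ?_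
  change ‖act A w y‖ ≤ _
  have e : ‖x‖ ^ 2 • act A w y = dot y x • p + cross x y • act A w (rot x) := by
    have := congrArg (act A w) (normsq_smul_eq x y)
    simpa [act, hp] using this
  have h1 : ‖x‖ ^ 2 * ‖act A w y‖ ≤ ‖y‖ * ‖x‖ * ‖p‖ + ‖x‖ * ‖y‖ * (‖p‖ *
      (κ * ‖x‖ ^ 2 * S + ‖x‖ ^ 2 / stretch A x w)) := by
    calc ‖x‖ ^ 2 * ‖act A w y‖ = ‖‖x‖ ^ 2 • act A w y‖ := by
          rw [norm_smul, Real.norm_eq_abs, abs_of_nonneg (sq_nonneg _)]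
      _ ≤ |dot y x| * ‖p‖ + |cross x y| * ‖act A w (rot x)‖ := by
          rw [e, ← Real.norm_eq_abs, ← Real.norm_eq_abs, ← norm_smul, ← norm_smul]
          exact norm_add_le _ _
      _ ≤ _ := add_le_add (mul_le_mul_of_nonneg_right (abs_dot_le y x) hp0'.le)
          (mul_le_mul (abs_cross_le x y) hrot (norm_nonneg _) (by positivity))
  rw [div_mul_eq_mul_div, le_div_iff₀ hx']
  refine le_of_mul_le_mul_left ?_ hx'
  linarith

theorem stretch_cons_le {x : EuclideanSpace ℝ (Fin 2)} (i : Fin N) (s : List (Fin N)) :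
    stretch A x (i :: s) ≤ κ * stretch A x s := by
  have hd := absDet_pos A [i]
  have hs := absDet_pos A s
  rw [show i :: s = [i] ++ s from rfl, stretch, stretch, act_append, absDet_append,
    div_le_iff₀ (by positivity)]
  calc ‖act A [i] (act A s x)‖ ^ 2 ≤ (alpha₁ A [i] * ‖act A s x‖) ^ 2 := by
        gcongr
        exact norm_act_le A [i] _
    _ = alpha₁ A [i] ^ 2 * ‖act A s x‖ ^ 2 := by ring
    _ ≤ κ * absDet A [i] * ‖act A s x‖ ^ 2 := by gcongr; exact hκ i
    _ = _ := by field_simp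

theorem stretch_le_cons {x : EuclideanSpace ℝ (Fin 2)} (i : Fin N) (s : List (Fin N)) :
    stretch A x s ≤ κ * stretch A x (i :: s) := by
  have hd := absDet_pos A [i]
  have hs := absDet_pos A s
  rw [show i :: s = [i] ++ s from rfl, stretch, stretch, act_append, absDet_append,
    div_le_iff₀ hs]
  have h := absDet_mul_norm_le A [i] (act A s x)
  have h2 : (absDet A [i] * ‖act A s x‖) ^ 2 ≤ (alpha₁ A [i] * ‖act A [i] (act A s x)‖) ^ 2 := by
    gcongr
  have h3 : absDet A [i] * ‖act A s x‖ ^ 2 ≤ κ * ‖act A [i] (act A s x)‖ ^ 2 := by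
    refine le_of_mul_le_mul_left ?_ hd
    calc _ = (absDet A [i] * ‖act A s x‖) ^ 2 := by ring
      _ ≤ _ := h2
      _ = alpha₁ A [i] ^ 2 * ‖act A [i] (act A s x)‖ ^ 2 := by ring
      _ ≤ κ * absDet A [i] * ‖act A [i] (act A s x)‖ ^ 2 := by gcongr; exact hκ i
      _ = _ := by ring
  calc ‖act A s x‖ ^ 2 ≤ κ * ‖act A [i] (act A s x)‖ ^ 2 / absDet A [i] := by
        rwa [le_div_iff₀' hd]
    _ = _ := by field_simp

end Distortion

end WordAction

/-! ### Domination makes the larger singular value almost multiplicative -/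

section Domination

theorem summable_linear_sq_mul_pow (a b : ℝ) {t : ℝ} (h0 : 0 < t) (h1 : t < 1) :
    Summable fun n : ℕ => (a * n + b) ^ 2 * t ^ n := by
  have hn : ‖t‖ < 1 := by rwa [Real.norm_eq_abs, abs_of_pos h0]
  have s2 := (summable_pow_mul_geometric_of_norm_lt_one 2 hn).mul_left (a ^ 2)
  have s1 := (summable_pow_mul_geometric_of_norm_lt_one 1 hn).mul_left (2 * a * b)
  have s0 := (summable_pow_mul_geometric_of_norm_lt_one 0 hn).mul_left (b ^ 2)
  refine ((s2.add s1).add s0).congr fun n => ?_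
  ring

variable {N : ℕ}

theorem exists_minimal_suffix (Q : List (Fin N) → Prop) (v : List (Fin N)) :
    (∀ s, s <:+ v → ¬Q s) ∨ ∃ x, x <:+ v ∧ Q x ∧ ∀ s, s <:+ x → s ≠ x → ¬Q s := by
  induction v with
  | nil =>
    by_cases h : Q []
    · exact Or.inr ⟨[], List.suffix_rfl, h, fun s hs hne => absurd (List.suffix_nil.1 hs) hne⟩
    · left
      intro s hs
      rwa [List.suffix_nil.1 hs]
  | cons i v ih =>
    rcases ih with ih | ⟨x, hx, hQ, hmin⟩
    · by_cases h : Q (i :: v)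
      · refine Or.inr ⟨_, List.suffix_rfl, h, fun s hs hne => ?_⟩
        rcases List.suffix_cons_iff.1 hs with h' | h'
        · exact absurd h' hne
        · exact ih s h'
      · left
        intro s hs
        rcases List.suffix_cons_iff.1 hs with rfl | h'
        · exact h
        · exact ih s h'
    · exact Or.inr ⟨x, hx.trans (List.suffix_cons i v), hQ, hmin⟩

theorem exists_maximal_suffix (P : List (Fin N) → Prop) (h0 : P []) (w : List (Fin N)) :
    ∃ y w', y ++ w' = w ∧ P w' ∧ ∀ z, z <:+ y → z ≠ [] → ¬P (z ++ w') := by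
  induction w with
  | nil => exact ⟨[], [], rfl, h0, fun z hz hne => absurd (List.suffix_nil.1 hz) hne⟩
  | cons i w ih =>
    by_cases h : P (i :: w)
    · exact ⟨[], i :: w, rfl, h, fun z hz hne => absurd (List.suffix_nil.1 hz) hne⟩
    · obtain ⟨y, w', rfl, hP, hmax⟩ := ih
      refine ⟨i :: y, w', rfl, hP, fun z hz hne => ?_⟩
      rcases List.suffix_cons_iff.1 hz with rfl | h'
      · exact h
      · exact hmax z h' hne

theorem suffix_append_cases {s x y : List (Fin N)} (h : s <:+ x ++ y) :
    s <:+ y ∨ ∃ x', x' <:+ x ∧ s = x' ++ y := by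
  rcases List.suffix_or_suffix_of_suffix h (List.suffix_append x y) with h' | ⟨x', rfl⟩
  · exact Or.inl h'
  · exact Or.inr ⟨x', List.suffix_append_self_iff.1 h, rfl⟩

variable {A : Fin N → Matrix.GeneralLinearGroup (Fin 2) ℝ} {κ C t : ℝ}

theorem norm_act_sq (x : EuclideanSpace ℝ (Fin 2)) (w : List (Fin N)) :
    ‖act A w x‖ ^ 2 = stretch A x w * absDet A w := by
  rw [stretch, div_mul_cancel₀ _ (absDet_pos A w).ne']

section Estimates

variable (h1κ : 1 ≤ κ) (hκ : ∀ i, alpha₁ A [i] ^ 2 ≤ κ * absDet A [i]) (hC : 0 < C)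
  (h0t : 0 < t) (ht1 : t < 1)
  (hdom : ∀ w : List (Fin N), absDet A w ≤ C * t ^ w.length * alpha₁ A w ^ 2)

include h1κ hκ in
theorem norm_sq_le_stretch {x : EuclideanSpace ℝ (Fin 2)} (u : List (Fin N))
    (h : ∀ s, s <:+ u → s ≠ u → ‖x‖ ^ 2 ≤ stretch A x s) : ‖x‖ ^ 2 ≤ κ * stretch A x u := by
  cases u with
  | nil =>
    rw [stretch_nil]
    exact le_mul_of_one_le_left (sq_nonneg _) h1κ
  | cons i s =>
    exact (h s (List.suffix_cons i s) (by simp)).trans (stretch_le_cons hκ i s)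

include h1κ hκ h0t ht1 hdom in
/-- A word along which a direction is only moderately stretched, in comparison with all proper
suffixes, is short. -/
theorem exists_length_lt : ∃ n₀ : ℕ, ∀ (x : EuclideanSpace ℝ (Fin 2)) (u : List (Fin N)), x ≠ 0 →
    (∀ s, s <:+ u → s ≠ u → ‖x‖ ^ 2 ≤ stretch A x s) → stretch A x u ≤ κ * ‖x‖ ^ 2 →
    u.length < n₀ := by
  have hs := ((summable_linear_sq_mul_pow κ (1 + κ) h0t ht1).mul_left
    (κ * C)).tendsto_atTop_zero
  -- The shear is at most linear in n, so α₁(u)² is at most a quadratic polynomial in n times |det|.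
  -- Domination gives |det| ≤ C t^n α₁(u)², and beyond n₀ the product of these factors is below 1.
  obtain ⟨n₀, hn₀⟩ := eventually_atTop.1 (hs.eventually_lt_const one_pos)
  refine ⟨n₀, fun x u hx hlow hup => ?_⟩
  by_contra! hlen
  have hlt := hn₀ _ hlen
  have hx' : 0 < ‖x‖ := norm_pos_iff.2 hx
  have hst := stretch_pos A hx u
  have hα := alpha₁_pos A u
  have hb := norm_sq_le_stretch h1κ hκ u hlow
  set n := u.length with hn
  have hS : suffixSum (fun s => (stretch A x s)⁻¹) u ≤ n * (‖x‖ ^ 2)⁻¹ := by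
    refine (suffixSum_le (b := fun _ => (‖x‖ ^ 2)⁻¹) fun s h1 h2 => ?_).trans (by simp [hn])
    exact inv_anti₀ (by positivity) (hlow s h1 h2)
  have hmain := alpha₁_mul_norm_le hκ hx u
  have hQ : 1 + κ * ‖x‖ ^ 2 * suffixSum (fun s => (stretch A x s)⁻¹) u
      + ‖x‖ ^ 2 / stretch A x u ≤ κ * n + (1 + κ) := by
    have e1 : κ * ‖x‖ ^ 2 * suffixSum (fun s => (stretch A x s)⁻¹) u ≤ κ * n := by
      calc _ ≤ κ * ‖x‖ ^ 2 * (n * (‖x‖ ^ 2)⁻¹) := by gcongr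
        _ = κ * n := by field_simp
    have e2 : ‖x‖ ^ 2 / stretch A x u ≤ κ := by rwa [div_le_iff₀ hst]
    linarith
  have hsq : (alpha₁ A u * ‖x‖) ^ 2 ≤ (‖act A u x‖ * (κ * n + (1 + κ))) ^ 2 := by
    have := hmain.trans (mul_le_mul_of_nonneg_left hQ (norm_nonneg (act A u x)))
    exact pow_le_pow_left₀ (by positivity) this 2
  rw [mul_pow, mul_pow, norm_act_sq] at hsq
  have hd := hdom u
  have hd0 := absDet_pos A u
  have h3 : alpha₁ A u ^ 2 * ‖x‖ ^ 2
      ≤ (κ * C * ((κ * n + (1 + κ)) ^ 2 * t ^ n)) * (alpha₁ A u ^ 2 * ‖x‖ ^ 2) := by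
    calc _ ≤ _ := hsq
      _ ≤ κ * ‖x‖ ^ 2 * (C * t ^ n * alpha₁ A u ^ 2) * (κ * n + (1 + κ)) ^ 2 := by gcongr
      _ = _ := by ring
  have h4 : 0 < alpha₁ A u ^ 2 * ‖x‖ ^ 2 := by positivity
  exact absurd h3 (not_le.2 (mul_lt_of_lt_one_left h4 hlt))

include h1κ hκ h0t ht1 hdom hC in
/-- If no suffix contracts a direction much, then the word stretches it by nearly its norm. -/
theorem exists_alpha₁_le_mul_norm_act {η : ℝ} (hη : 0 < η) :
    ∃ B : ℝ, 0 < B ∧ ∀ (x : EuclideanSpace ℝ (Fin 2)) (v : List (Fin N)), x ≠ 0 →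
    (∀ s, s <:+ v → η * ‖x‖ ^ 2 ≤ stretch A x s) → alpha₁ A v * ‖x‖ ≤ B * ‖act A v x‖ := by
  have hs := (summable_linear_sq_mul_pow (κ / η) (1 + 1 / η) h0t ht1).mul_left C
  -- Bootstrap: the lower bound on the stretches gives shears linear in n. With domination the
  -- inverse stretches are then at most the summable `b n` times ‖x‖⁻², and returning this to the
  -- shear estimate gives a bound independent of n.
  set b : ℕ → ℝ := fun n => C * ((κ / η * n + (1 + 1 / η)) ^ 2 * t ^ n) with hbdef
  have hb0 : ∀ n, 0 ≤ b n := fun n => by rw [hbdef]; positivity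
  have hB0 : 0 ≤ ∑' n, b n := tsum_nonneg hb0
  refine ⟨1 + κ * ∑' n, b n + 1 / η, by positivity, fun x v hx hlow => ?_⟩
  have hx' : 0 < ‖x‖ := norm_pos_iff.2 hx
  have hquot : ∀ u, u <:+ v → ‖x‖ ^ 2 / stretch A x u ≤ 1 / η := by
    intro u hu
    rw [div_le_div_iff₀ (stretch_pos A hx u) hη]
    linarith [hlow u hu]
  have hinv : ∀ u, u <:+ v → (stretch A x u)⁻¹ ≤ (1 / η) * (‖x‖ ^ 2)⁻¹ := by
    intro u hu
    have := hquot u hu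
    rw [← div_eq_mul_inv, le_div_iff₀ (by positivity)]
    rwa [div_eq_inv_mul] at this
  have hterm : ∀ u, u <:+ v → (stretch A x u)⁻¹ ≤ b u.length * (‖x‖ ^ 2)⁻¹ := by
    intro u hu
    have hst := stretch_pos A hx u
    have hS : suffixSum (fun s => (stretch A x s)⁻¹) u ≤ u.length * ((1 / η) * (‖x‖ ^ 2)⁻¹) := by
      refine (suffixSum_le (b := fun _ => (1 / η) * (‖x‖ ^ 2)⁻¹) fun s h1 _ => ?_).trans (by simp)
      exact hinv s (h1.trans hu)
    have hmain := alpha₁_mul_norm_le hκ hx u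
    have hQ : 1 + κ * ‖x‖ ^ 2 * suffixSum (fun s => (stretch A x s)⁻¹) u
        + ‖x‖ ^ 2 / stretch A x u ≤ κ / η * u.length + (1 + 1 / η) := by
      have e1 : κ * ‖x‖ ^ 2 * suffixSum (fun s => (stretch A x s)⁻¹) u ≤ κ / η * u.length := by
        calc _ ≤ κ * ‖x‖ ^ 2 * (u.length * ((1 / η) * (‖x‖ ^ 2)⁻¹)) := by gcongr
          _ = _ := by field_simp
      linarith [hquot u hu]
    have hsq : (alpha₁ A u * ‖x‖) ^ 2
        ≤ (‖act A u x‖ * (κ / η * u.length + (1 + 1 / η))) ^ 2 := by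
      have := hmain.trans (mul_le_mul_of_nonneg_left hQ (norm_nonneg (act A u x)))
      exact pow_le_pow_left₀ (mul_nonneg (alpha₁_pos A u).le hx'.le) this 2
    rw [mul_pow, mul_pow, norm_act_sq] at hsq
    have hd := hdom u
    have hd0 := absDet_pos A u
    rw [← div_eq_mul_inv, le_div_iff₀ (by positivity), inv_mul_le_iff₀ hst]
    refine le_of_mul_le_mul_left ?_ hd0
    calc absDet A u * ‖x‖ ^ 2 ≤ C * t ^ u.length * alpha₁ A u ^ 2 * ‖x‖ ^ 2 := by gcongr
      _ = C * t ^ u.length * (alpha₁ A u ^ 2 * ‖x‖ ^ 2) := by ring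
      _ ≤ C * t ^ u.length * (stretch A x u * absDet A u *
          (κ / η * u.length + (1 + 1 / η)) ^ 2) := by gcongr
      _ = _ := by rw [hbdef]; ring
  have hS : suffixSum (fun s => (stretch A x s)⁻¹) v ≤ (∑' n, b n) * (‖x‖ ^ 2)⁻¹ := by
    refine (suffixSum_le (b := fun n => b n * (‖x‖ ^ 2)⁻¹) fun s h1 _ => hterm s h1).trans ?_
    rw [← Finset.sum_mul]
    exact mul_le_mul_of_nonneg_right (hs.sum_le_tsum _ fun n _ => hb0 n) (by positivity)
  have hQ : 1 + κ * ‖x‖ ^ 2 * suffixSum (fun s => (stretch A x s)⁻¹) v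
      + ‖x‖ ^ 2 / stretch A x v ≤ 1 + κ * ∑' n, b n + 1 / η := by
    have e1 : κ * ‖x‖ ^ 2 * suffixSum (fun s => (stretch A x s)⁻¹) v ≤ κ * ∑' n, b n := by
      calc _ ≤ κ * ‖x‖ ^ 2 * ((∑' n, b n) * (‖x‖ ^ 2)⁻¹) := by gcongr
        _ = _ := by field_simp
    linarith [hquot v List.suffix_rfl]
  rw [mul_comm (1 + _ + _)]
  exact (alpha₁_mul_norm_le hκ hx v).trans
    (mul_le_mul_of_nonneg_left hQ (norm_nonneg (act A v x)))

include h1κ hκ in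
theorem stretch_append_le {x : EuclideanSpace ℝ (Fin 2)} (y w : List (Fin N)) :
    stretch A x (y ++ w) ≤ κ ^ y.length * stretch A x w := by
  induction y with
  | nil => simp
  | cons i y ih =>
    rw [List.cons_append, List.length_cons, pow_succ, mul_comm _ κ, mul_assoc]
    exact (stretch_cons_le hκ i _).trans (mul_le_mul_of_nonneg_left ih (by linarith))

include h1κ hκ h0t ht1 hdom hC in
-- Follow a nearly maximally stretched direction f of A_w through the suffixes of v ++ w, which are
-- the successive stages of the action. If the stretch stays comparable to its value H at w, then
-- A_v is nearly maximal on A_w f. If it rises to H from far below and later drops far again, the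
-- excursion has to be short by `exists_length_lt`, but a short word cannot change the stretch that
-- much.
theorem exists_alpha₁_mul_le : ∃ D : ℝ, 1 ≤ D ∧ ∀ v w : List (Fin N),
    alpha₁ A v * alpha₁ A w ≤ D * alpha₁ A (v ++ w) := by
  obtain ⟨n₀, hn₀⟩ := exists_length_lt h1κ hκ h0t ht1 hdom
  have hκ0 : 0 < κ := by linarith
  -- Chosen so that n₀ letters, each changing the stretch by a factor at most κ, cannot lift it from
  -- η H to H.
  set η : ℝ := (2 * κ ^ n₀)⁻¹ with hη
  have hκn : 1 ≤ κ ^ n₀ := one_le_pow₀ h1κ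
  have hη0 : 0 < η := by positivity
  have hη1 : η < 1 := inv_lt_one_of_one_lt₀ (by linarith)
  have hηn : κ ^ n₀ * η < 1 := by
    rw [hη, mul_inv, mul_comm (2 : ℝ)⁻¹, ← mul_assoc, mul_inv_cancel₀ (by positivity)]
    norm_num
  obtain ⟨B, hB, hBle⟩ := exists_alpha₁_le_mul_norm_act h1κ hκ hC h0t ht1 hdom hη0
  refine ⟨max 1 (max (4 / η) (2 * B)), le_max_left _ _, fun v w => ?_⟩
  obtain ⟨f, hf, hfw⟩ := exists_le_norm_act A w
  have hf' : 0 < ‖f‖ := norm_pos_iff.2 hf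
  have hαv := alpha₁_pos A v
  have hαw := alpha₁_pos A w
  have hαvw := alpha₁_pos A (v ++ w)
  have hdw := absDet_pos A w
  set H := stretch A f w with hH
  have hHpos : 0 < H := stretch_pos A hf w
  -- If H is not large against ‖f‖², then A_w is conformal up to a constant and α₁(v) α₂(w) ≤ α₁(vw)
  -- suffices.
  rcases lt_or_ge (η * H) (‖f‖ ^ 2) with hcase | hcase
  · have h1 : alpha₁ A w ^ 2 * η ≤ 4 * absDet A w := by
      have h2 : (alpha₁ A w * ‖f‖) ^ 2 ≤ (2 * ‖act A w f‖) ^ 2 :=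
        pow_le_pow_left₀ (by positivity) hfw 2
      rw [mul_pow, mul_pow, norm_act_sq] at h2
      refine le_of_mul_le_mul_right ?_ (pow_pos hf' 2)
      calc alpha₁ A w ^ 2 * η * ‖f‖ ^ 2 = η * (alpha₁ A w ^ 2 * ‖f‖ ^ 2) := by ring
        _ ≤ η * (2 ^ 2 * (H * absDet A w)) := by gcongr
        _ = 4 * absDet A w * (η * H) := by ring
        _ ≤ _ := by gcongr
    have h3 := alpha₁_mul_alpha₂_le A v w
    rw [alpha₂_eq] at h3
    have h4 : alpha₁ A v * alpha₁ A w ≤ 4 / η * alpha₁ A (v ++ w) := by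
      rw [div_mul_eq_mul_div, le_div_iff₀ hη0]
      calc alpha₁ A v * alpha₁ A w * η
          = alpha₁ A v * (alpha₁ A w)⁻¹ * (alpha₁ A w ^ 2 * η) := by field_simp
        _ ≤ alpha₁ A v * (alpha₁ A w)⁻¹ * (4 * absDet A w) := by gcongr
        _ = 4 * (alpha₁ A v * (absDet A w * (alpha₁ A w)⁻¹)) := by ring
        _ ≤ _ := by gcongr
    refine h4.trans (mul_le_mul_of_nonneg_right ?_ hαvw.le)
    exact (le_max_left _ _).trans (le_max_right _ _)
  · rcases exists_minimal_suffix (fun s => stretch A f (s ++ w) < η * H) v with hno | ⟨x, hxv, hx,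
      hxmin⟩
    · have hg : act A w f ≠ 0 := act_ne_zero A w hf
      have h1 := hBle (act A w f) v hg fun s hs => by
        rw [stretch_act, norm_act_sq, ← mul_assoc]
        exact mul_le_mul_of_nonneg_right (not_lt.1 (hno s hs)) hdw.le
      rw [← act_append] at h1
      have h2 : alpha₁ A v * alpha₁ A w ≤ 2 * B * alpha₁ A (v ++ w) := by
        refine le_of_mul_le_mul_right ?_ hf'
        calc alpha₁ A v * alpha₁ A w * ‖f‖ = alpha₁ A v * (alpha₁ A w * ‖f‖) := by ring
          _ ≤ alpha₁ A v * (2 * ‖act A w f‖) := by gcongr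
          _ = 2 * (alpha₁ A v * ‖act A w f‖) := by ring
          _ ≤ 2 * (B * ‖act A (v ++ w) f‖) := by gcongr
          _ ≤ 2 * (B * (alpha₁ A (v ++ w) * ‖f‖)) := by gcongr; exact norm_act_le A _ f
          _ = _ := by ring
      refine h2.trans (mul_le_mul_of_nonneg_right ?_ hαvw.le)
      exact (le_max_right _ _).trans (le_max_right _ _)
    -- The stretch leaves the level η H for the last time after w' on the way up to w, and first
    -- falls below it after x. The word x ++ y between these two moments is the excursion.
    · exfalso
      obtain ⟨y, w', hyw, hPw', hmax⟩ := exists_maximal_suffix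
        (fun s => stretch A f s ≤ η * H) (by rwa [stretch_nil]) w
      have hdw' := absDet_pos A w'
      have hHw' := stretch_pos A hf w'
      have hy : y ≠ [] := by
        rintro rfl
        rw [List.nil_append] at hyw
        subst hyw
        exact absurd hPw' (not_le.2 (mul_lt_of_lt_one_left hHpos hη1))
      -- One letter beyond w' already exceeds η H, so the starting level is within a factor κ of it.
      have hlast : η * H < κ * stretch A f w' := by
        have hz : [y.getLast hy] <:+ y :=
          ⟨y.dropLast, List.dropLast_append_getLast hy⟩
        exact (not_le.1 (hmax _ hz (by simp))).trans_le (stretch_cons_le hκ _ w')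
      have hlen := hn₀ (act A w' f) (x ++ y) (act_ne_zero A w' hf) (fun s hs hne => by
          rw [stretch_act, norm_act_sq]
          refine mul_le_mul_of_nonneg_right ?_ hdw'.le
          rcases suffix_append_cases hs with hs' | ⟨x', hx', rfl⟩
          · rcases eq_or_ne s [] with rfl | hs0
            · exact le_rfl
            · exact hPw'.trans (not_le.1 (hmax s hs' hs0)).le
          · rw [List.append_assoc, hyw]
            refine hPw'.trans (not_lt.1 (hxmin x' hx' ?_))
            rintro rfl
            exact hne rfl) (by
          rw [stretch_act, norm_act_sq, ← mul_assoc, List.append_assoc, hyw]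
          exact mul_le_mul_of_nonneg_right (hx.le.trans hlast.le) hdw'.le)
      have hylen : y.length ≤ n₀ := by
        rw [List.length_append] at hlen
        omega
      -- The climb from w' to w takes at most n₀ letters, which contradicts the choice of η.
      have h5 : H ≤ κ ^ n₀ * (η * H) := by
        calc H = stretch A f (y ++ w') := by rw [hH, hyw]
          _ ≤ κ ^ y.length * stretch A f w' := stretch_append_le h1κ hκ y w'
          _ ≤ κ ^ n₀ * (η * H) :=
            mul_le_mul (pow_le_pow_right₀ h1κ hylen) hPw' hHw'.le (by positivity)
      rw [← mul_assoc] at h5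
      exact absurd h5 (not_le.2 (mul_lt_of_lt_one_left hHpos hηn))

end Estimates

/-- For a dominated tuple, the larger singular value is almost multiplicative. -/
theorem exists_almostMul_alpha₁ (hdom : Dominated A) : ∃ K, AlmostMul (alpha₁ A) K := by
  obtain ⟨C, t, hC, h0t, ht1, hd⟩ := hdom
  obtain ⟨κ, h1κ, hκ⟩ : ∃ κ : ℝ, 1 ≤ κ ∧ ∀ i, alpha₁ A [i] ^ 2 ≤ κ * absDet A [i] := by
    -- A sum over the letters serves as an upper bound for the maximum.
    refine ⟨1 + ∑ i, alpha₁ A [i] ^ 2 / absDet A [i], ?_, fun i => ?_⟩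
    · have : 0 ≤ ∑ i, alpha₁ A [i] ^ 2 / absDet A [i] :=
        Finset.sum_nonneg fun i _ => div_nonneg (sq_nonneg _) (absDet_pos A _).le
      linarith
    · rw [← div_le_iff₀ (absDet_pos A _)]
      have := Finset.single_le_sum (f := fun i => alpha₁ A [i] ^ 2 / absDet A [i])
        (fun i _ => div_nonneg (sq_nonneg _) (absDet_pos A _).le) (Finset.mem_univ i)
      linarith
  have hd' : ∀ w : List (Fin N), absDet A w ≤ C * t ^ w.length * alpha₁ A w ^ 2 := by
    intro w
    have h := hd w
    have hα := alpha₁_pos A w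
    rw [alpha₂_eq, ← div_eq_mul_inv, div_le_iff₀ hα] at h
    linarith
  obtain ⟨D, hD, hle⟩ := exists_alpha₁_mul_le h1κ hκ hC h0t ht1 hd'
  refine ⟨_, AlmostMul.of_le (alpha₁_pos A) (by linarith : 0 < D) (fun v w => ?_) hle⟩
  have := mul_pos (alpha₁_pos A v) (alpha₁_pos A w)
  exact (alpha₁_append_le A v w).trans (le_mul_of_one_le_left this.le hD)

theorem almostMul_absDet (A : Fin N → Matrix.GeneralLinearGroup (Fin 2) ℝ) :
    AlmostMul (absDet A) 0 where
  pos := absDet_pos A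
  abs_log_le v w := by
    rw [absDet_append, Real.log_mul (absDet_pos A v).ne' (absDet_pos A w).ne']
    simp

theorem exists_almostMul_alpha₂ (hdom : Dominated A) : ∃ K, AlmostMul (alpha₂ A) K := by
  obtain ⟨K, hK⟩ := exists_almostMul_alpha₁ hdom
  rw [show alpha₂ A = fun w => absDet A w * (alpha₁ A w)⁻¹ from funext (alpha₂_eq A)]
  exact ⟨_, (almostMul_absDet A).mul hK.inv⟩

end Domination

/-! ### The singular value function -/

section SingularValueFunction

variable {N : ℕ} {A : Fin N → Matrix.GeneralLinearGroup (Fin 2) ℝ}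

theorem exists_log_alpha₁_le [NeZero N] (hA : Contractive A) :
    ∃ r : ℝ, 0 < r ∧ ∀ w, Real.log (alpha₁ A w) ≤ -(w.length * r) := by
  obtain ⟨i₀, hi₀⟩ := Finite.exists_max fun i => Real.log (alpha₁ A [i])
  have h1 : ∀ i, alpha₁ A [i] = opNorm (A i : Matrix (Fin 2) (Fin 2) ℝ) := fun i => by
    simp [alpha₁, wordProd]
  refine ⟨-Real.log (alpha₁ A [i₀]), ?_, fun w => ?_⟩
  · have := Real.log_neg (alpha₁_pos A [i₀]) ((h1 i₀).trans_lt (hA i₀))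
    linarith
  · induction w with
    | nil =>
      have : alpha₁ A [] ≤ 1 := by
        refine ContinuousLinearMap.opNorm_le_bound _ zero_le_one fun x => ?_
        change ‖act A [] x‖ ≤ _
        rw [act_nil, one_mul]
      simpa using Real.log_nonpos (alpha₁_pos A []).le this
    | cons i w ih =>
      have h2 := Real.log_le_log (alpha₁_pos A _) (alpha₁_append_le A [i] w)
      rw [Real.log_mul (alpha₁_pos A _).ne' (alpha₁_pos A _).ne'] at h2
      have h3 := hi₀ i
      rw [List.singleton_append] at h2
      rw [List.length_cons]
      push_cast
      linarith

theorem alpha₂_le_alpha₁ (w : List (Fin N)) : alpha₂ A w ≤ alpha₁ A w := by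
  obtain ⟨x, hx, -⟩ := exists_le_norm_act A w
  have hα := alpha₁_pos A w
  have h := (absDet_mul_norm_le A w x).trans
    (mul_le_mul_of_nonneg_left (norm_act_le A w x) hα.le)
  rw [← mul_assoc] at h
  rw [alpha₂_eq, ← div_eq_mul_inv, div_le_iff₀ hα]
  exact le_of_mul_le_mul_right h (norm_pos_iff.2 hx)

theorem log_absDet (w : List (Fin N)) :
    Real.log (absDet A w) = Real.log (alpha₁ A w) + Real.log (alpha₂ A w) := by
  rw [← Real.log_mul (alpha₁_pos A w).ne' (alpha₂_pos A w).ne', alpha₂_eq]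
  congr 1
  have := alpha₁_pos A w
  field_simp

theorem log_svf (s : ℝ) (w : List (Fin N)) :
    Real.log (svf A s w) = if s < 1 then s * Real.log (alpha₁ A w)
      else if s < 2 then Real.log (alpha₁ A w) + (s - 1) * Real.log (alpha₂ A w)
      else s / 2 * (Real.log (alpha₁ A w) + Real.log (alpha₂ A w)) := by
  have h1 := alpha₁_pos A w
  have h2 := alpha₂_pos A w
  unfold svf
  split_ifs
  · rw [Real.log_rpow h1]
  · rw [Real.log_mul h1.ne' (Real.rpow_pos_of_pos h2 _).ne', Real.log_rpow h2]
  · rw [← log_absDet, ← Real.log_rpow (absDet_pos A w)]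
    rfl

/-- The difference log φ^{s'} - log φ^s is a combination of log α₁ and log α₂ with nonnegative
coefficients of sum s' - s, also when s and s' lie in different ranges of the definition. Both
logarithms are at most -|w| r. -/
theorem log_svf_le {r : ℝ} (hr : ∀ w, Real.log (alpha₁ A w) ≤ -(w.length * r)) {s s' : ℝ}
    (hss : s ≤ s') (w : List (Fin N)) :
    Real.log (svf A s' w) ≤ Real.log (svf A s w) + w.length * (-(s' - s) * r) := by
  have h1 := hr w
  have h2 := Real.log_le_log (alpha₂_pos A w) (alpha₂_le_alpha₁ (A := A) w)
  rw [log_svf, log_svf]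
  set a := Real.log (alpha₁ A w)
  set b := Real.log (alpha₂ A w)
  set m := w.length * r with hm
  have e : w.length * (-(s' - s) * r) = -((s' - s) * m) := by rw [hm]; ring
  rw [e]
  have ha : a + m ≤ 0 := by linarith
  have hb : b + m ≤ 0 := by linarith
  split_ifs
  · nlinarith [mul_nonpos_of_nonneg_of_nonpos (sub_nonneg.2 hss) ha]
  · linarith
  · linarith
  · nlinarith [mul_nonpos_of_nonneg_of_nonpos (by linarith : 0 ≤ 1 - s) ha,
      mul_nonpos_of_nonneg_of_nonpos (by linarith : 0 ≤ s' - 1) hb]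
  · nlinarith [mul_nonpos_of_nonneg_of_nonpos (sub_nonneg.2 hss) hb]
  · linarith
  · nlinarith [mul_nonpos_of_nonneg_of_nonpos (by linarith : 0 ≤ s' / 2 - s) ha,
      mul_nonpos_of_nonneg_of_nonpos (by linarith : 0 ≤ s' / 2) hb]
  · nlinarith [mul_nonpos_of_nonneg_of_nonpos (by linarith : 0 ≤ s' / 2 - 1) ha,
      mul_nonpos_of_nonneg_of_nonpos (by linarith : 0 ≤ s' / 2 - s + 1) hb]
  · nlinarith [mul_nonpos_of_nonneg_of_nonpos (by linarith : 0 ≤ (s' - s) / 2) ha,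
      mul_nonpos_of_nonneg_of_nonpos (by linarith : 0 ≤ (s' - s) / 2) hb]

theorem exists_almostMul_svf (hdom : Dominated A) (s : ℝ) : ∃ K, AlmostMul (svf A s) K := by
  obtain ⟨K₁, h1⟩ := exists_almostMul_alpha₁ hdom
  obtain ⟨K₂, h2⟩ := exists_almostMul_alpha₂ hdom
  rcases lt_or_ge s 1 with hs1 | hs1
  · rw [show svf A s = fun w => alpha₁ A w ^ s from funext fun w => if_pos hs1]
    exact ⟨_, h1.rpow s⟩
  · rcases lt_or_ge s 2 with hs2 | hs2
    · rw [show svf A s = fun w => alpha₁ A w * alpha₂ A w ^ (s - 1) from funext fun w => by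
        rw [svf, if_neg hs1.not_gt, if_pos hs2]]
      exact ⟨_, h1.mul (h2.rpow (s - 1))⟩
    · rw [show svf A s = fun w => absDet A w ^ (s / 2) from funext fun w => by
        rw [svf, if_neg hs1.not_gt, if_neg hs2.not_gt, absDet]]
      exact ⟨_, (almostMul_absDet A).rpow (s / 2)⟩

/-- The pairs (b, c) are (1, α₁), (α₁ / α₂, α₂) and (1, |det|^(1/2)) on the three intervals. On
each, log φ^s is therefore affine in s, which is why the theorem asks for a common interval. -/
theorem exists_svf_eq [NeZero N] (hA : Contractive A) (hdom : Dominated A) {J : Set ℝ}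
    (hJ : J = Set.Ioo 0 1 ∨ J = Set.Ioo 1 2 ∨ J = Set.Ioi 2) :
    ∃ (b c : List (Fin N) → ℝ) (Kb Kc r : ℝ), AlmostMul b Kb ∧ AlmostMul c Kc ∧ 0 < r ∧
      (∀ w, Real.log (c w) ≤ -(w.length * r)) ∧ ∀ s ∈ J, ∀ w, svf A s w = b w * c w ^ s := by
  obtain ⟨K₁, h1⟩ := exists_almostMul_alpha₁ hdom
  obtain ⟨K₂, h2⟩ := exists_almostMul_alpha₂ hdom
  obtain ⟨r, hr0, hr⟩ := exists_log_alpha₁_le hA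
  have hr2 : ∀ w, Real.log (alpha₂ A w) ≤ -(w.length * r) := fun w =>
    (Real.log_le_log (alpha₂_pos A w) (alpha₂_le_alpha₁ w)).trans (hr w)
  rcases hJ with rfl | rfl | rfl
  · refine ⟨_, _, _, _, r, AlmostMul.one, h1, hr0, hr, fun s hs w => ?_⟩
    rw [svf, if_pos hs.2, one_mul]
  · refine ⟨_, _, _, _, r, h1.mul h2.inv, h2, hr0, hr2, fun s hs w => ?_⟩
    have := alpha₂_pos A w
    rw [svf, if_neg hs.1.le.not_gt, if_pos hs.2, Real.rpow_sub_one this.ne']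
    field_simp
  · refine ⟨_, _, _, _, r, AlmostMul.one, (almostMul_absDet A).rpow (1 / 2), hr0, fun w => ?_,
      fun s hs w => ?_⟩
    · rw [Real.log_rpow (absDet_pos A w), log_absDet]
      linarith [hr w, hr2 w]
    · have hs' : 2 < s := hs
      rw [svf, if_neg (by linarith : ¬s < 1), if_neg hs'.le.not_gt, one_mul,
        ← Real.rpow_mul (absDet_pos A w).le, absDet]
      congr 1
      ring

theorem Lam_lt_zero {c : List (Fin N) → ℝ} {K r : ℝ} (hc : AlmostMul c K) (hr0 : 0 < r)
    (hr : ∀ w, Real.log (c w) ≤ -(w.length * r)) {ν : Measure (Shift N)}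
    (hν : IsInvariantProb ν) : Lam c ν < 0 := by
  have h1 : Lam (fun _ : List (Fin N) => (1 : ℝ)) ν = 0 := by
    simpa using (AlmostMul.one (N := N)).Lam_rpow 0 hν
  have h2 := AlmostMul.one.Lam_le hc hν (a := -r) fun w => by
    rw [Real.log_one]
    linarith [hr w]
  linarith

end SingularValueFunction

/-! ### The zero of the pressure in s -/

section PressureZero

variable {N : ℕ} {A : Fin N → Matrix.GeneralLinearGroup (Fin 2) ℝ} {μ : Measure (Shift N)}

theorem exists_almostMul_psi (hdom : Dominated A) {Ka : ℝ}
    (hμ : AlmostMul (fun w => μ.real (cylinder w)) Ka) (q s : ℝ) :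
    ∃ K, AlmostMul (psi A μ q s) K :=
  let ⟨_, h⟩ := exists_almostMul_svf hdom s
  ⟨_, (hμ.rpow q).mul (h.rpow (1 - q))⟩

theorem log_psi (hdom : Dominated A) {Ka : ℝ}
    (hμ : AlmostMul (fun w => μ.real (cylinder w)) Ka) (q s : ℝ) (w : List (Fin N)) :
    Real.log (psi A μ q s w)
      = q * Real.log (μ.real (cylinder w)) + (1 - q) * Real.log (svf A s w) := by
  obtain ⟨_, h⟩ := exists_almostMul_svf hdom s
  have h1 := hμ.pos w
  have h2 := h.pos w
  rw [psi, Real.log_mul (Real.rpow_pos_of_pos h1 _).ne' (Real.rpow_pos_of_pos h2 _).ne',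
    Real.log_rpow h1, Real.log_rpow h2]

/-- Strict monotonicity in s; its direction depends on the sign of 1 - q, and the factor 1 - q
treats both signs at once. -/
theorem mul_pressure_psi_le [NeZero N] (hdom : Dominated A) {Ka r : ℝ}
    (hμ : AlmostMul (fun w => μ.real (cylinder w)) Ka)
    (hr : ∀ w, Real.log (alpha₁ A w) ≤ -(w.length * r)) (q : ℝ) {s s' : ℝ}
    (hss : s ≤ s') :
    (1 - q) * pressure (psi A μ q s') ≤ (1 - q) * pressure (psi A μ q s)
      - (1 - q) ^ 2 * ((s' - s) * r) := by
  obtain ⟨_, h⟩ := exists_almostMul_psi hdom hμ q s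
  obtain ⟨_, h'⟩ := exists_almostMul_psi hdom hμ q s'
  rcases le_total q 1 with hq | hq
  · have := h.pressure_le h' (a := (1 - q) * (-(s' - s) * r)) fun w => by
      rw [log_psi hdom hμ, log_psi hdom hμ]
      have := mul_le_mul_of_nonneg_left (log_svf_le hr hss w) (sub_nonneg.2 hq)
      linarith
    have := mul_le_mul_of_nonneg_left this (sub_nonneg.2 hq)
    linarith
  · have := h'.pressure_le h (a := (q - 1) * (-(s' - s) * r)) fun w => by
      rw [log_psi hdom hμ, log_psi hdom hμ]
      have := mul_le_mul_of_nonneg_left (log_svf_le hr hss w) (sub_nonneg.2 hq)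
      linarith
    have := mul_le_mul_of_nonneg_left this (sub_nonneg.2 hq)
    linarith

theorem pressure_psi_injective [NeZero N] (hdom : Dominated A) {Ka r : ℝ}
    (hμ : AlmostMul (fun w => μ.real (cylinder w)) Ka) (hr0 : 0 < r)
    (hr : ∀ w, Real.log (alpha₁ A w) ≤ -(w.length * r)) {q : ℝ} (hq : q ≠ 1) :
    Function.Injective fun s => pressure (psi A μ q s) := by
  have hq2 : 0 < (1 - q) ^ 2 := by
    have := sub_ne_zero.2 hq.symm
    positivity
  have key : ∀ s s', s < s' → pressure (psi A μ q s) ≠ pressure (psi A μ q s') := by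
    intro s s' hss e
    have := mul_pressure_psi_le hdom hμ hr q hss.le
    rw [e] at this
    have h2 := mul_pos hq2 (mul_pos (sub_pos.2 hss) hr0)
    linarith
  intro s s' e
  rcases lt_trichotomy s s' with h | h | h
  · exact absurd e (key s s' h)
  · exact h
  · exact absurd e.symm (key s' s h)

theorem pressureZero_eq [NeZero N] (hdom : Dominated A) {Ka r : ℝ}
    (hμ : AlmostMul (fun w => μ.real (cylinder w)) Ka) (hr0 : 0 < r)
    (hr : ∀ w, Real.log (alpha₁ A w) ≤ -(w.length * r)) {q : ℝ} (hq : q ≠ 1) {s : ℝ}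
    (hs : 0 ≤ s) (h : pressure (psi A μ q s) = 0) : pressureZero A μ q = s := by
  rw [pressureZero, show {s : ℝ | 0 ≤ s ∧ pressure (psi A μ q s) = 0} = {s} from ?_,
    csInf_singleton]
  ext s'
  constructor
  · rintro ⟨-, h'⟩
    exact pressure_psi_injective hdom hμ hr0 hr hq (h'.trans h.symm)
  · rintro rfl
    exact ⟨hs, h⟩

/-- If there were no zero, the infimum of the empty set would give the default value 0. Positivity
thus replaces an existence proof. -/
theorem pressure_psi_pressureZero [NeZero N] (hdom : Dominated A) {Ka r : ℝ}
    (hμ : AlmostMul (fun w => μ.real (cylinder w)) Ka) (hr0 : 0 < r)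
    (hr : ∀ w, Real.log (alpha₁ A w) ≤ -(w.length * r)) {q : ℝ} (hq : q ≠ 1)
    (h : 0 < pressureZero A μ q) : pressure (psi A μ q (pressureZero A μ q)) = 0 := by
  rcases Set.eq_empty_or_nonempty {s : ℝ | 0 ≤ s ∧ pressure (psi A μ q s) = 0} with he | hne
  · rw [pressureZero, he, Real.sInf_empty] at h
    exact absurd h (lt_irrefl 0)
  · obtain ⟨s, hs, hs0⟩ := hne
    rwa [pressureZero_eq hdom hμ hr0 hr hq hs hs0]

variable {b c : List (Fin N) → ℝ} {Ka Kb Kc : ℝ} {J : Set ℝ}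

theorem psi_eq_family (hb : AlmostMul b Kb)
    (hc : AlmostMul c Kc) (q : ℝ) {s : ℝ} (hs : ∀ w, svf A s w = b w * c w ^ s) :
    psi A μ q s = family (fun w => μ.real (cylinder w)) b c (q, (q - 1) * s) := by
  funext w
  have hc' := hc.pos w
  rw [psi, family, hs, Real.mul_rpow (hb.pos w).le (Real.rpow_pos_of_pos hc' _).le,
    ← Real.rpow_mul hc'.le, ← mul_assoc]
  congr 2
  ring

/-- Near a parameter at which the zero of the pressure lies in `J`, the zero depends continuously
on the parameter. -/
theorem eventually_pressureZero_mem [NeZero N] (hdom : Dominated A) {r : ℝ}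
    (hμ : AlmostMul (fun w => μ.real (cylinder w)) Ka) (hb : AlmostMul b Kb)
    (hc : AlmostMul c Kc) (hr0 : 0 < r) (hr : ∀ w, Real.log (alpha₁ A w) ≤ -(w.length * r))
    (hJ : ∀ s ∈ J, ∀ w, svf A s w = b w * c w ^ s) (hJ0 : ∀ s ∈ J, 0 ≤ s) {q : ℝ} (hq : q ≠ 1)
    {ε : ℝ} (hε : 0 < ε)
    (hsub : Set.Icc (pressureZero A μ q - ε) (pressureZero A μ q + ε) ⊆ J)
    (hzero : pressure (psi A μ q (pressureZero A μ q)) = 0) :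
    ∀ᶠ q' in 𝓝 q, pressureZero A μ q' ∈ Set.Icc (pressureZero A μ q - ε)
        (pressureZero A μ q + ε) ∧ pressure (psi A μ q' (pressureZero A μ q')) = 0 := by
  set s₀ := pressureZero A μ q with hs₀
  -- The fixed factor 1 - q makes g(q, ·) decreasing on J. Its strict signs at s₀ ± ε persist for q'
  -- near q by continuity, and the intermediate value theorem then gives a zero in between.
  let g : ℝ × ℝ → ℝ := fun x => (1 - q) * pressure
    (family (fun w => μ.real (cylinder w)) b c (x.1, (x.1 - 1) * x.2))
  have hg : Continuous g := continuous_const.mul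
    ((continuous_pressure_family hμ hb hc).comp (by fun_prop))
  have hgJ : ∀ q' s, s ∈ J → g (q', s) = (1 - q) * pressure (psi A μ q' s) := fun q' s hs => by
    rw [psi_eq_family hb hc q' (hJ s hs)]
  have m1 : s₀ - ε ∈ J := hsub ⟨le_rfl, by linarith⟩
  have m2 : s₀ + ε ∈ J := hsub ⟨by linarith, le_rfl⟩
  have m0 : s₀ ∈ J := hsub ⟨by linarith, by linarith⟩
  have hq2 : 0 < (1 - q) ^ 2 := by
    have := sub_ne_zero.2 hq.symm
    positivity
  have hpos : 0 < (1 - q) ^ 2 * (ε * r) := by positivity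
  have g1 : 0 < g (q, s₀ - ε) := by
    rw [hgJ _ _ m1]
    have := mul_pressure_psi_le hdom hμ hr q (by linarith : s₀ - ε ≤ s₀)
    rw [hzero, sub_sub_cancel] at this
    linarith
  have g2 : g (q, s₀ + ε) < 0 := by
    rw [hgJ _ _ m2]
    have := mul_pressure_psi_le hdom hμ hr q (by linarith : s₀ ≤ s₀ + ε)
    rw [hzero, add_sub_cancel_left] at this
    linarith
  have c1 : Continuous fun q' => g (q', s₀ - ε) := hg.comp (by fun_prop)
  have c2 : Continuous fun q' => g (q', s₀ + ε) := hg.comp (by fun_prop)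
  filter_upwards [(c1.tendsto q).eventually_const_lt g1, (c2.tendsto q).eventually_lt_const g2,
    isOpen_ne.mem_nhds hq] with q' h1 h2 hq'
  have c3 : Continuous fun s => g (q', s) := hg.comp (by fun_prop)
  obtain ⟨s, hs, hs0⟩ := intermediate_value_Icc' (by linarith : s₀ - ε ≤ s₀ + ε) c3.continuousOn
    ⟨h2.le, h1.le⟩
  have hsJ := hsub hs
  simp only at hs0
  rw [hgJ _ _ hsJ] at hs0
  have hs0' := (mul_eq_zero.1 hs0).resolve_left (sub_ne_zero.2 hq.symm)
  rw [pressureZero_eq hdom hμ hr0 hr hq' (hJ0 _ hsJ) hs0']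
  exact ⟨hs, hs0'⟩

theorem exists_Icc_subset {J : Set ℝ} (hJ : IsOpen J) {s : ℝ} (hs : s ∈ J) {δ : ℝ} (hδ : 0 < δ) :
    ∃ ε, 0 < ε ∧ ε < δ ∧ Set.Icc (s - ε) (s + ε) ⊆ J := by
  obtain ⟨ε, hε, h⟩ := Metric.isOpen_iff.1 hJ s hs
  refine ⟨min ε δ / 2, by positivity, ?_, fun x hx => h ?_⟩
  · linarith [min_le_right ε δ, lt_min hε hδ]
  · rw [Metric.mem_ball, Real.dist_eq, abs_lt]
    have := min_le_left ε δ
    have := lt_min hε hδ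
    constructor <;> linarith [hx.1, hx.2]

end PressureZero

end SelfAffine

/-! ### The dimension formula -/

theorem mainTheorem7 (N : ℕ) (A : Fin N → Matrix.GeneralLinearGroup (Fin 2) ℝ)
    (hA : SelfAffine.Contractive A) (hdom : SelfAffine.Dominated A)
    (μ : MeasureTheory.Measure (SelfAffine.Shift N)) [MeasureTheory.IsProbabilityMeasure μ]
    (hμ : SelfAffine.QuasiBernoulli μ) (q : ℝ) (hq : q ≠ 1)
    (J : Set ℝ) (hJ : J = Set.Ioo 0 1 ∨ J = Set.Ioo 1 2 ∨ J = Set.Ioi 2)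
    (hs : SelfAffine.Lqτ A μ q / (q - 1) ∈ J)
    (hd : q * deriv (SelfAffine.Lqτ A μ) q - SelfAffine.Lqτ A μ q ∈ J) :
    DifferentiableAt ℝ (SelfAffine.Lqτ A μ) q ∧
    (∃! ν : MeasureTheory.Measure (SelfAffine.Shift N),
      SelfAffine.IsEquilibriumState
        (SelfAffine.psi A μ q (SelfAffine.Lqτ A μ q / (q - 1))) ν) ∧
    ∀ ν : MeasureTheory.Measure (SelfAffine.Shift N),
      SelfAffine.IsEquilibriumState
        (SelfAffine.psi A μ q (SelfAffine.Lqτ A μ q / (q - 1))) ν →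
      SelfAffine.IsLyapunovDim A ν
        (q * deriv (SelfAffine.Lqτ A μ) q - SelfAffine.Lqτ A μ q) := by
  open SelfAffine in
  have hne : Nonempty (Shift N) := nonempty_of_isProbabilityMeasure μ
  have : NeZero N := ⟨by
    rintro rfl
    exact (hne.some 0).elim0⟩
  obtain ⟨Ka, ha⟩ := AlmostMul.of_almostMultiplicative
    (fun w => ENNReal.toReal_pos (hμ.1 w).ne' (measure_ne_top μ _)) hμ.2
  change AlmostMul (fun w => μ.real (cylinder w)) Ka at ha
  obtain ⟨r, hr0, hr⟩ := exists_log_alpha₁_le hA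
  obtain ⟨b, c, Kb, Kc, r', hb, hc, hr0', hr', hsvf⟩ := exists_svf_eq hA hdom hJ
  have hJo : IsOpen J := by
    rcases hJ with rfl | rfl | rfl
    exacts [isOpen_Ioo, isOpen_Ioo, isOpen_Ioi]
  have hJpos : ∀ s ∈ J, 0 < s := by
    rcases hJ with rfl | rfl | rfl
    exacts [fun s h => h.1, fun s h => zero_lt_one.trans h.1, fun s h => zero_lt_two.trans h]
  have hJ0 : ∀ s ∈ J, 0 ≤ s := fun s h => (hJpos s h).le
  have hτ : ∀ q', Lqτ A μ q' = (q' - 1) * pressureZero A μ q' := by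
    intro q'
    rw [Lqτ]
    split_ifs with h
    · rw [h, sub_self, zero_mul]
    · rfl
  have hs₀ : Lqτ A μ q / (q - 1) = pressureZero A μ q := by
    rw [hτ, mul_div_cancel_left₀ _ (sub_ne_zero.2 hq)]
  rw [hs₀] at hs ⊢
  have hzero := pressure_psi_pressureZero hdom ha hr0 hr hq (hJpos _ hs)
  have hev : ∀ δ > 0, ∀ᶠ q' in 𝓝 q, |pressureZero A μ q' - pressureZero A μ q| < δ ∧
      pressureZero A μ q' ∈ J ∧ pressure (psi A μ q' (pressureZero A μ q')) = 0 := by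
    intro δ hδ
    obtain ⟨ε, hε, hεδ, hsub⟩ := exists_Icc_subset hJo hs hδ
    filter_upwards [eventually_pressureZero_mem hdom ha hb hc hr0 hr hsvf hJ0 hq hε hsub hzero]
      with q' hq'
    refine ⟨?_, hsub hq'.1, hq'.2⟩
    rw [abs_lt]
    constructor <;> linarith [hq'.1.1, hq'.1.2]
  have hcont : ContinuousAt (pressureZero A μ) q := by
    rw [ContinuousAt, Metric.tendsto_nhds]
    exact fun δ hδ => (hev δ hδ).mono fun q' h => h.1
  have hτfun : Lqτ A μ = fun q' => (q' - 1) * pressureZero A μ q' := funext hτ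
  have hτcont : ContinuousAt (Lqτ A μ) q := by
    rw [hτfun]
    exact (continuousAt_id.sub continuousAt_const).mul hcont
  have hpsi : ∀ q', pressureZero A μ q' ∈ J → psi A μ q' (pressureZero A μ q')
      = family (fun w => μ.real (cylinder w)) b c (q', Lqτ A μ q') := fun q' h => by
    rw [psi_eq_family hb hc q' (hsvf _ h), hτ]
  have hneg : ∀ ν, IsInvariantProb ν → Lam c ν < 0 := fun ν hν => Lam_lt_zero hc hr0' hr' hν
  -- Differentiability is settled before `hd` is used, so `deriv` is a genuine derivative there.
  have hderiv : ∀ ν, IsEquilibriumState (psi A μ q (pressureZero A μ q)) ν →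
      HasDerivAt (Lqτ A μ)
        ((Lam (fun w => μ.real (cylinder w)) ν - Lam b ν) / Lam c ν) q := by
    intro ν hν
    rw [hpsi q hs] at hν
    refine hasDerivAt_of_pressure_family_eq_zero ha hb hc hneg hτcont ?_ hν
    filter_upwards [hev 1 one_pos] with q' hq'
    rw [← hpsi q' hq'.2.1]
    exact hq'.2.2
  obtain ⟨K, hK⟩ := exists_almostMul_psi hdom ha q (pressureZero A μ q)
  obtain ⟨ν₀, hν₀⟩ := hK.exists_isGibbs
  have hE₀ := hν₀.isEquilibriumState hK
  refine ⟨(hderiv ν₀ hE₀).differentiableAt, ⟨ν₀, hE₀, fun η hη =>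
    hν₀.eq_of_isEquilibriumState hK hη⟩, fun ν hν => ?_⟩
  have hdν := (hderiv ν hν).deriv
  have hcν := hneg ν hν.1
  rw [eq_div_iff hcν.ne] at hdν
  have hbal := hν.2
  rw [hzero, hpsi q hs, Lam_family ha hb hc _ hν.1] at hbal
  set d := q * deriv (Lqτ A μ) q - Lqτ A μ q with hd_def
  -- Here d must lie in J, so that φ^d has the same factors b and c as at the zero of the pressure.
  have hLd : Lam (svf A d) ν = Lam b ν + d * Lam c ν := by
    rw [show svf A d = fun w => b w * c w ^ d from funext (hsvf d hd),
      hb.Lam_mul (hc.rpow d) hν.1, hc.Lam_rpow d hν.1]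
  have hd0 : entropy ν + Lam (svf A d) ν = 0 := by
    rw [hLd, hd_def]
    simp only at hbal
    linear_combination q * hdν - hbal
  refine ⟨⟨hJ0 d hd, hd0⟩, fun s _ hs1 => ?_⟩
  -- Strict monotonicity of Λ(φ^s, ν) in s makes d the only solution.
  have hmono : ∀ s s', s < s' → Lam (svf A s') ν < Lam (svf A s) ν := by
    intro s s' hlt
    obtain ⟨_, h1⟩ := exists_almostMul_svf hdom s
    obtain ⟨_, h2⟩ := exists_almostMul_svf hdom s'
    have := h1.Lam_le h2 hν.1 fun w => log_svf_le hr hlt.le w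
    linarith [mul_pos (sub_pos.2 hlt) hr0]
  rcases lt_trichotomy s d with h | h | h
  · linarith [hmono s d h]
  · exact h
  · linarith [hmono d s h]
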